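/- **Theorem.** Let $n\ge 0$ be an integer, $L=\mathbb{Z}^n$, let $A\in GL(n,\mathbb{Q})$, and let $L'$ be a finite-index subgroup of $L\cap A^{-1}L$; put $L''=A\,L'\leqslant L$. Let $$G(A,L')=\langle L,\ t \mid t\,c\,t^{-1}=A\,c\ \text{ for all } c\in L'\rangle$$ be the HNN-extension of $L$ in which the stable letter $t$ conjugates $L'$ to $L''$ via multiplication by $A$. Suppose that there is a matrix $R\in GL(n,\mathbb{Z})$ such that 1. $R^2=I_n$; 2. $RAR=A^{-1}$; 3. $R\,L'=L''$. Then there are a group $H$ containing $L$ as a subgroup of index $2$ such that every element of $H\setminus L$ acts on $L$ by conjugation as multiplication by $R$, and a group $H'$ containing $L'$ as a subgroup of index $2$ such that every element of $H'\setminus L'$ acts on $L'$ by conjugation as multiplication by $RA$. For any such $H$ and $H'$, let $K=H*_{L'=L'}H'$ be the free product of $H$ and $H'$ amalgamated along the subgroup $L'\leqslant L\leqslant H$ and the subgroup $L'\leqslant H'$. Then: * $G(A,L')$ embeds as a subgroup of index $2$ in $K$, by an embedding that restricts on $L$ to the inclusion $L\leqslant H\leqslant K$; * if $n=2$ and $A$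 is conjugate in $GL(2,\mathbb{R})$ to an element of $SO(2)$, then $K$ is a CAT(0) group, i.e. it acts properly and cocompactly by isometries on a non-empty CAT(0) space. -/

import Mathlib

namespace CommHNN

/-! ### Lattices in `ℚⁿ` -/

/-- The inclusion `ℤⁿ → ℚⁿ`. -/
def castVec (n : ℕ) : (Fin n → ℤ) →+ (Fin n → ℚ) :=
  (Int.castAddHom ℚ).compLeft (Fin n)

/-- Multiplication of column vectors by the matrix `A`. -/
def mulVecHom {n : ℕ} (A : GL (Fin n) ℚ) : (Fin n → ℚ) →+ (Fin n → ℚ) :=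
  (Matrix.mulVecLin (A : Matrix (Fin n) (Fin n) ℚ)).toAddMonoidHom

/-- The map `ℤⁿ → ℚⁿ`, `v ↦ A v`. -/
def latticeMap {n : ℕ} (A : GL (Fin n) ℚ) : (Fin n → ℤ) →+ (Fin n → ℚ) :=
  (mulVecHom A).comp (castVec n)

/-- The matrix `R`, regarded as a matrix with rational entries. -/
def toRat {n : ℕ} (R : GL (Fin n) ℤ) : GL (Fin n) ℚ :=
  Matrix.GeneralLinearGroup.map (Int.castRingHom ℚ) R

/-- The matrix `A`, regarded as a matrix with real entries. -/
noncomputable def toReal {n : ℕ} (A : GL (Fin n) ℚ) : GL (Fin n) ℝ :=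
  Matrix.GeneralLinearGroup.map (algebraMap ℚ ℝ) A

/-- `L ∩ A⁻¹ L` for `L = ℤⁿ`, as a subgroup of `L`: the integer vectors `v` with `A v ∈ ℤⁿ`. -/
def interLattice {n : ℕ} (A : GL (Fin n) ℚ) : AddSubgroup (Fin n → ℤ) :=
  (castVec n).range.comap (latticeMap A)

/-- `A L' ∩ ℤⁿ` as a subgroup of `ℤⁿ`; it is `A L'` as soon as `L' ≤ L ∩ A⁻¹ L`. -/
def imageLattice {n : ℕ} (A : GL (Fin n) ℚ) (L' : AddSubgroup (Fin n → ℤ)) :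
    AddSubgroup (Fin n → ℤ) :=
  (L'.map (latticeMap A)).comap (castVec n)

theorem castVec_injective (n : ℕ) : Function.Injective (castVec n) := by
  intro v w h
  funext i
  have := congrFun h i
  exact_mod_cast (show ((v i : ℤ) : ℚ) = ((w i : ℤ) : ℚ) from this)

theorem mulVecHom_injective {n : ℕ} (A : GL (Fin n) ℚ) : Function.Injective (mulVecHom A) :=
  Matrix.mulVec_injective_of_isUnit A.isUnit

theorem latticeMap_injective {n : ℕ} (A : GL (Fin n) ℚ) : Function.Injective (latticeMap A) :=
  (mulVecHom_injective A).comp (castVec_injective n)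

theorem map_imageLattice {n : ℕ} (A : GL (Fin n) ℚ) {L' : AddSubgroup (Fin n → ℤ)}
    (hL' : L' ≤ interLattice A) :
    (imageLattice A L').map (castVec n) = L'.map (latticeMap A) := by
  refine AddSubgroup.map_comap_eq_self ?_
  rintro _ ⟨v, hv, rfl⟩
  exact hL' hv

/-- The isomorphism `L' → A L'`, `v ↦ A v`. -/
noncomputable def latticeEquiv {n : ℕ} (A : GL (Fin n) ℚ) (L' : AddSubgroup (Fin n → ℤ))
    (hL' : L' ≤ interLattice A) : L' ≃+ imageLattice A L' :=
  (L'.equivMapOfInjective (latticeMap A) (latticeMap_injective A)).trans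
    (((imageLattice A L').equivMapOfInjective (castVec n) (castVec_injective n)).trans
      (AddEquiv.addSubgroupCongr (map_imageLattice A hL'))).symm

theorem castVec_latticeEquiv {n : ℕ} (A : GL (Fin n) ℚ) (L' : AddSubgroup (Fin n → ℤ))
    (hL' : L' ≤ interLattice A) (v : L') :
    castVec n (latticeEquiv A L' hL' v : Fin n → ℤ)
      = (A : Matrix (Fin n) (Fin n) ℚ).mulVec (castVec n (v : Fin n → ℤ)) := by
  set e := ((imageLattice A L').equivMapOfInjective (castVec n) (castVec_injective n)).trans
      (AddEquiv.addSubgroupCongr (map_imageLattice A hL')) with he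
  have h := e.apply_symm_apply (L'.equivMapOfInjective (latticeMap A) (latticeMap_injective A) v)
  exact congrArg Subtype.val h

/-! ### The HNN-extension `G(A, L')` -/

/-- The isomorphism `L' → A L'`, `v ↦ A v`, between subgroups of `L = ℤⁿ` written
multiplicatively. -/
noncomputable def stableEquiv {n : ℕ} (A : GL (Fin n) ℚ) (L' : AddSubgroup (Fin n → ℤ))
    (hL' : L' ≤ interLattice A) :
    AddSubgroup.toSubgroup L' ≃* AddSubgroup.toSubgroup (imageLattice A L') where
  toFun v := ⟨Multiplicative.ofAdd (latticeEquiv A L' hL' ⟨Multiplicative.toAdd v.1, v.2⟩).1,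
    (latticeEquiv A L' hL' ⟨Multiplicative.toAdd v.1, v.2⟩).2⟩
  invFun w := ⟨Multiplicative.ofAdd
      ((latticeEquiv A L' hL').symm ⟨Multiplicative.toAdd w.1, w.2⟩).1,
    ((latticeEquiv A L' hL').symm ⟨Multiplicative.toAdd w.1, w.2⟩).2⟩
  left_inv v := Subtype.ext (congrArg Subtype.val
    ((latticeEquiv A L' hL').symm_apply_apply ⟨Multiplicative.toAdd v.1, v.2⟩))
  right_inv w := Subtype.ext (congrArg Subtype.val
    ((latticeEquiv A L' hL').apply_symm_apply ⟨Multiplicative.toAdd w.1, w.2⟩))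
  map_mul' v w := Subtype.ext (congrArg Subtype.val
    ((latticeEquiv A L' hL').map_add ⟨Multiplicative.toAdd v.1, v.2⟩
      ⟨Multiplicative.toAdd w.1, w.2⟩))

/-- The group `G(A, L') = ⟨ L, t ∥ t c t⁻¹ = A c for all c ∈ L' ⟩`, where `L = ℤⁿ`. -/
abbrev G {n : ℕ} (A : GL (Fin n) ℚ) (L' : AddSubgroup (Fin n → ℤ))
    (hL' : L' ≤ interLattice A) : Type :=
  HNNExtension (Multiplicative (Fin n → ℤ)) (AddSubgroup.toSubgroup L')
    (AddSubgroup.toSubgroup (imageLattice A L')) (stableEquiv A L' hL')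

/-! ### Index-two overgroups -/

/-- `ι` embeds the lattice `V` (with coordinates given by `j : V → ℚⁿ`) as a subgroup of index two
of `H`, and every element of `H` outside `V` acts on `V` by conjugation as multiplication by the
matrix `B`.  Equivalently, `H` is an extension with kernel `V` and quotient of order two, whose
generator acts on `V` as `B`. -/
structure IsIndexTwoOvergroup {n : ℕ} {V : Type} [AddCommGroup V] {H : Type} [Group H]
    (j : V →+ (Fin n → ℚ)) (B : Matrix (Fin n) (Fin n) ℚ) (ι : Multiplicative V →* H) :
    Prop where
  injective : Function.Injective ι
  index_eq : ι.range.index = 2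
  conj : ∀ h : H, h ∉ ι.range → ∀ v : V, ∃ w : V, j w = B.mulVec (j v) ∧
    h * ι (Multiplicative.ofAdd v) * h⁻¹ = ι (Multiplicative.ofAdd w)

/-! ### Amalgamated free products of two groups -/

section Amalgam

/-- The family consisting of the two groups `H` (at `false`) and `H'` (at `true`). -/
def Fam (H H' : Type) : Bool → Type
  | false => H
  | true => H'

instance Fam.instGroup (H H' : Type) [Group H] [Group H'] : ∀ b, Group (Fam H H' b)
  | false => inferInstanceAs (Group H)
  | true => inferInstanceAs (Group H')

/-- The family consisting of the two homomorphisms `f : C → H` and `f' : C → H'`. -/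
def famHom {C H H' : Type} [Group C] [Group H] [Group H'] (f : C →* H) (f' : C →* H') :
    ∀ b, C →* Fam H H' b
  | false => f
  | true => f'

/-- The free product of `H` and `H'` amalgamated along `C` by means of `f : C → H` and
`f' : C → H'`. -/
abbrev Amalgam {C H H' : Type} [Group C] [Group H] [Group H'] (f : C →* H) (f' : C →* H') :
    Type :=
  Monoid.PushoutI (famHom f f')

/-- The canonical homomorphism `H → H *_C H'`. -/
def Amalgam.inl {C H H' : Type} [Group C] [Group H] [Group H'] (f : C →* H) (f' : C →* H') :
    H →* Amalgam f f' :=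
  Monoid.PushoutI.of (φ := famHom f f') false

/-- The canonical homomorphism `H' → H *_C H'`. -/
def Amalgam.inr {C H H' : Type} [Group C] [Group H] [Group H'] (f : C →* H) (f' : C →* H') :
    H' →* Amalgam f f' :=
  Monoid.PushoutI.of (φ := famHom f f') true

end Amalgam

/-- For embeddings `ι : ℤⁿ → H` and `ι' : L' → H'`, with `L' ≤ ℤⁿ`, the amalgamated free product
`H *_{L' = L'} H'`. -/
abbrev K {n : ℕ} {L' : AddSubgroup (Fin n → ℤ)} {H H' : Type} [Group H] [Group H']
    (ι : Multiplicative (Fin n → ℤ) →* H) (ι' : Multiplicative L' →* H') : Type :=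
  Amalgam (ι.comp (AddMonoidHom.toMultiplicative L'.subtype)) ι'

/-! ### CAT(0) spaces and CAT(0) groups -/

/-- `γ` restricts to a geodesic from `x` to `y`, i.e. to an isometric embedding of the interval
`[0, dist x y]` that starts at `x` and ends at `y`. -/
structure IsGeodesic {X : Type} [MetricSpace X] (γ : ℝ → X) (x y : X) : Prop where
  source : γ 0 = x
  target : γ (dist x y) = y
  isometry : ∀ s ∈ Set.Icc 0 (dist x y), ∀ t ∈ Set.Icc 0 (dist x y),
    dist (γ s) (γ t) = |s - t|

/-- A CAT(0) space: a geodesic metric space in which every geodesic triangle is at least as thin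
as its comparison triangle in the Euclidean plane.  In the triangle with vertices `p`, `q`, `r`
the two points that are compared lie on the sides `α` and `β` that meet in `p`; the names of the
vertices are arbitrary, and two points on the same side have the same distance as their comparison
points. -/
structure IsCAT0Space (X : Type) [MetricSpace X] : Prop where
  geodesic : ∀ x y : X, ∃ γ : ℝ → X, IsGeodesic γ x y
  thin : ∀ (p q r : X) (α β : ℝ → X), IsGeodesic α p q → IsGeodesic β p r →
    ∀ p' q' r' : EuclideanSpace ℝ (Fin 2),
      dist p' q' = dist p q → dist p' r' = dist p r → dist q' r' = dist q r →
    ∀ s ∈ Set.Icc 0 (dist p q), ∀ t ∈ Set.Icc 0 (dist p r),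
    ∀ x' ∈ segment ℝ p' q', ∀ y' ∈ segment ℝ p' r', dist p' x' = s → dist p' y' = t →
      dist (α s) (β t) ≤ dist x' y'

/-- A group acts geometrically on a metric space if it acts by isometries, properly (every point
has a ball that meets only finitely many of its translates) and cocompactly. -/
structure IsGeometricAction (Γ X : Type) [Group Γ] [MetricSpace X] [MulAction Γ X] : Prop where
  isometric : ∀ (g : Γ) (x y : X), dist (g • x) (g • y) = dist x y
  proper : ∀ x : X, ∃ ε > 0,
    {g : Γ | ∃ y ∈ Metric.ball x ε, g • y ∈ Metric.ball x ε}.Finite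
  cocompact : ∃ C : Set X, IsCompact C ∧ ∀ x : X, ∃ g : Γ, ∃ c ∈ C, g • c = x

/-- A CAT(0) group: a group that acts geometrically on a (non-empty) CAT(0) space. -/
def IsCAT0Group (Γ : Type) [Group Γ] : Prop :=
  ∃ (X : Type) (_ : MetricSpace X) (_ : MulAction Γ X),
    Nonempty X ∧ IsCAT0Space X ∧ IsGeometricAction Γ X

end CommHNN

/-! Existence: the identities `R² = 1`, `(R A)² = 1` and `R A L' = L'` make `R` and `R A`
involutions of `L` and `L'`, so semidirect products with a group of order two serve as `H` and `H'`.

Embedding: pick `h` in `H` outside `L` and `h'` in `H'` outside `L'`, and put `a = h²`, `b = h'²`.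
Since `R (R A) = A`, sending `t` to `h h'` defines a homomorphism from `G(A, L')` to `K`.
Injectivity needs no normal forms: conjugation by `h` is mirrored by the endomorphism `σ` with `v ↦
R v` and `t ↦ a b t⁻¹`, whose square is conjugation by `a`. By `exists_square_root`, `G(A, L')`
embeds in a group with a square root `u` of `a` inducing `σ`; then `h ↦ u`, `h' ↦ u⁻¹ t` extends
this embedding to `K`. The index is two because a sign character sends `h` and `h'` to `-1` and
kills the image (`exists_embedding`).

CAT(0): `K` acts on the `ℓ²`-product of a tree and a Euclidean space. The tree is spanned by `K`
with the distance `d(g, k)` equal to the number of syllables of `g⁻¹ k`, which satisfies the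
four-point condition (`length_four_point`). On the Euclidean side, averaging an `A`-invariant inner
product over `R` makes `R` and `R A` isometries (`exists_invariant_norm`); `H` and `H'` then act
affinely, with `L` and `L'` as translations (`exists_affine_action`), and the two actions agree on
`L'`. As `L'` has finite index in both factors, properness and cocompactness reduce to those of the
lattice `L'` acting on the Euclidean factor (`IsAmalgam.isCAT0Group`). The CAT(0) condition is
checked through the Bruhat–Tits inequality, which holds for trees and inner product spaces and
passes to products. -/

namespace CommHNN

/-! ### The CN inequality -/

/-- The inequality of Bruhat and Tits, for all points of a segment in place of its midpoint. -/
def HasCN (X : Type*) [PseudoMetricSpace X] : Prop :=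
  ∀ y z : X, ∀ t ∈ Set.Icc (0 : ℝ) 1, ∃ m : X, ∀ x : X,
    dist x m ^ 2 ≤ (1 - t) * dist x y ^ 2 + t * dist x z ^ 2 - t * (1 - t) * dist y z ^ 2

/-- Stewart's theorem, the equality case of the inequality; it also computes distances in comparison
triangles. -/
theorem dist_sq_convexComb {E : Type*} [NormedAddCommGroup E] [InnerProductSpace ℝ E]
    (x y z : E) (t : ℝ) :
    dist x ((1 - t) • y + t • z) ^ 2
      = (1 - t) * dist x y ^ 2 + t * dist x z ^ 2 - t * (1 - t) * dist y z ^ 2 := by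
  have h1 : x - ((1 - t) • y + t • z) = (1 - t) • (x - y) + t • (x - z) := by module
  have h2 : y - z = (x - z) - (x - y) := by abel
  rw [dist_eq_norm, dist_eq_norm, dist_eq_norm, dist_eq_norm, h1, h2, norm_add_sq_real,
    norm_sub_sq_real (x - z), norm_smul, norm_smul, mul_pow, mul_pow, inner_smul_left, inner_smul_right,
    Real.norm_eq_abs, Real.norm_eq_abs, sq_abs, sq_abs, real_inner_comm (x - z)]
  simp only [conj_trivial]
  ring

theorem hasCN_of_innerProductSpace (E : Type*) [NormedAddCommGroup E] [InnerProductSpace ℝ E] :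
    HasCN E :=
  fun y z t _ => ⟨(1 - t) • y + t • z, fun x => (dist_sq_convexComb x y z t).le⟩

theorem HasCN.separationQuotient {X : Type*} [PseudoMetricSpace X] (h : HasCN X) :
    HasCN (SeparationQuotient X) := by
  intro y z t ht
  obtain ⟨y, rfl⟩ := SeparationQuotient.surjective_mk y
  obtain ⟨z, rfl⟩ := SeparationQuotient.surjective_mk z
  obtain ⟨m, hm⟩ := h y z t ht
  refine ⟨SeparationQuotient.mk m, fun x => ?_⟩
  obtain ⟨x, rfl⟩ := SeparationQuotient.surjective_mk x
  simpa only [SeparationQuotient.dist_mk] using hm x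

theorem dist_sq_withLp {X Y : Type*} [PseudoMetricSpace X] [PseudoMetricSpace Y]
    (u v : WithLp 2 (X × Y)) :
    dist u v ^ 2 = dist u.fst v.fst ^ 2 + dist u.snd v.snd ^ 2 := by
  rw [WithLp.prod_dist_eq_add (by norm_num), ENNReal.toReal_ofNat, ← Real.sqrt_eq_rpow,
    Real.rpow_two, Real.rpow_two, Real.sq_sqrt (by positivity)]

/-- The inequality is linear in squared distances, and these add up in an `ℓ²`-product. -/
theorem HasCN.prod {X Y : Type*} [PseudoMetricSpace X] [PseudoMetricSpace Y] (hX : HasCN X)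
    (hY : HasCN Y) : HasCN (WithLp 2 (X × Y)) := by
  intro y z t ht
  obtain ⟨m, hm⟩ := hX y.fst z.fst t ht
  obtain ⟨n, hn⟩ := hY y.snd z.snd t ht
  refine ⟨WithLp.toLp 2 (m, n), fun x => ?_⟩
  rw [dist_sq_withLp, dist_sq_withLp, dist_sq_withLp, dist_sq_withLp]
  have h1 := hm x.fst
  have h2 := hn x.snd
  simp only [WithLp.toLp_fst, WithLp.toLp_snd]
  linarith

/-! ### From the Bruhat–Tits inequality to CAT(0) -/

section CAT0

variable {X : Type} [MetricSpace X]

/-- Because the inequality is available for every ratio, no completeness is needed: the points `m`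
for the ratios `s / dist x y` already form a geodesic. Testing against `x`, `y` and `γ s'` bounds
distances above; the triangle inequality bounds them below. -/
theorem HasCN.exists_isGeodesic (h : HasCN X) (x y : X) : ∃ γ : ℝ → X, IsGeodesic γ x y := by
  have h' : ∀ s : ℝ, ∃ m : X, s ∈ Set.Icc 0 (dist x y) → ∀ w : X,
      dist w m ^ 2 ≤ (1 - s / dist x y) * dist w x ^ 2 + s / dist x y * dist w y ^ 2
        - s / dist x y * (1 - s / dist x y) * dist x y ^ 2 := by
    intro s
    by_cases hs : s ∈ Set.Icc 0 (dist x y)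
    · obtain ⟨m, hm⟩ := h x y (s / dist x y)
        ⟨div_nonneg hs.1 dist_nonneg, div_le_one_of_le₀ hs.2 dist_nonneg⟩
      exact ⟨m, fun _ => hm⟩
    · exact ⟨x, fun h => absurd h hs⟩
  choose γ hγ using h'
  -- If `dist x y = 0`, then `s = 0` as well, so the default value of division by zero does no harm.
  have hdiv : ∀ s ∈ Set.Icc 0 (dist x y), s / dist x y * dist x y = s := by
    intro s hs
    rcases eq_or_ne (dist x y) 0 with h0 | h0
    · rw [h0] at hs
      rw [h0, mul_zero, le_antisymm hs.2 hs.1]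
    · exact div_mul_cancel₀ s h0
  have hsrc : ∀ s ∈ Set.Icc 0 (dist x y), dist x (γ s) ≤ s := by
    intro s hs
    refine abs_le_of_sq_le_sq' ?_ hs.1 |>.2
    refine (hγ s hs x).trans (le_of_eq ?_)
    have := hdiv s hs
    rw [dist_self]
    linear_combination (s / dist x y * dist x y + s) * this
  have htgt : ∀ s ∈ Set.Icc 0 (dist x y), dist y (γ s) ≤ dist x y - s := by
    intro s hs
    refine abs_le_of_sq_le_sq' ?_ (sub_nonneg.2 hs.2) |>.2
    refine (hγ s hs y).trans (le_of_eq ?_)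
    have := hdiv s hs
    rw [dist_self, dist_comm y x]
    linear_combination (s / dist x y * dist x y + s - 2 * dist x y) * this
  have hle : ∀ s ∈ Set.Icc 0 (dist x y), ∀ s' ∈ Set.Icc 0 (dist x y), s ≤ s' →
      dist (γ s) (γ s') = s' - s := by
    intro s hs s' hs' hss
    refine le_antisymm ?_ ?_
    · refine abs_le_of_sq_le_sq' ?_ (sub_nonneg.2 hss) |>.2
      have h1 := hγ s hs (γ s')
      have h2 : dist (γ s') x ^ 2 ≤ s' ^ 2 := by
        rw [dist_comm]; exact pow_le_pow_left₀ dist_nonneg (hsrc s' hs') 2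
      have h3 : dist (γ s') y ^ 2 ≤ (dist x y - s') ^ 2 := by
        rw [dist_comm]; exact pow_le_pow_left₀ dist_nonneg (htgt s' hs') 2
      have h4 : 0 ≤ s / dist x y := div_nonneg hs.1 dist_nonneg
      have h5 : 0 ≤ 1 - s / dist x y := sub_nonneg.2 (div_le_one_of_le₀ hs.2 dist_nonneg)
      have h6 := mul_le_mul_of_nonneg_left h2 h5
      have h7 := mul_le_mul_of_nonneg_left h3 h4
      rw [dist_comm]
      have h8 := hdiv s hs
      have h9 : (1 - s / dist x y) * s' ^ 2 + s / dist x y * (dist x y - s') ^ 2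
          - s / dist x y * (1 - s / dist x y) * dist x y ^ 2 = (s' - s) ^ 2 := by
        linear_combination (s / dist x y * dist x y + s - 2 * s') * h8
      linarith
    · have := dist_triangle4 x (γ s) (γ s') y
      have h1 := hsrc s hs
      have h2 := htgt s' hs'
      rw [dist_comm y] at h2
      linarith
  have h0 : (0 : ℝ) ∈ Set.Icc 0 (dist x y) := ⟨le_rfl, dist_nonneg⟩
  have h1 : dist x y ∈ Set.Icc 0 (dist x y) := ⟨dist_nonneg, le_rfl⟩
  refine ⟨γ, ⟨(dist_le_zero.1 (hsrc 0 h0)).symm,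
    (dist_le_zero.1 ((htgt _ h1).trans (sub_self _).le)).symm, fun s hs s' hs' => ?_⟩⟩
  rcases le_total s s' with hss | hss
  · rw [hle s hs s' hs' hss, abs_sub_comm, abs_of_nonneg (sub_nonneg.2 hss)]
  · rw [dist_comm, hle s' hs' s hs hss, abs_of_nonneg (sub_nonneg.2 hss)]

/-- Testing the inequality against the point of `γ` itself gives distance zero to `m`; so `m` lies
on every geodesic from `y` to `z`. -/
theorem HasCN.dist_sq_le_of_isGeodesic (h : HasCN X) {y z : X} {γ : ℝ → X}
    (hγ : IsGeodesic γ y z) {t : ℝ} (ht : t ∈ Set.Icc (0 : ℝ) 1) (x : X) :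
    dist x (γ (t * dist y z)) ^ 2
      ≤ (1 - t) * dist x y ^ 2 + t * dist x z ^ 2 - t * (1 - t) * dist y z ^ 2 := by
  obtain ⟨m, hm⟩ := h y z t ht
  have h0 : (0 : ℝ) ∈ Set.Icc 0 (dist y z) := ⟨le_rfl, dist_nonneg⟩
  have h1 : dist y z ∈ Set.Icc 0 (dist y z) := ⟨dist_nonneg, le_rfl⟩
  have hs : t * dist y z ∈ Set.Icc 0 (dist y z) :=
    ⟨mul_nonneg ht.1 dist_nonneg, mul_le_of_le_one_left dist_nonneg ht.2⟩
  have hy := hγ.isometry _ hs _ h0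
  have hz := hγ.isometry _ hs _ h1
  rw [hγ.source] at hy
  rw [hγ.target] at hz
  have hm' := hm (γ (t * dist y z))
  rw [hy, hz, sq_abs, sq_abs] at hm'
  have : dist (γ (t * dist y z)) m ^ 2 ≤ 0 := hm'.trans (le_of_eq (by ring))
  have h2 : γ (t * dist y z) = m :=
    dist_eq_zero.1 (pow_eq_zero_iff two_ne_zero |>.1 (le_antisymm this (sq_nonneg _)))
  rw [h2]
  exact hm x

theorem HasCN.isCAT0Space (h : HasCN X) : IsCAT0Space X where
  geodesic := h.exists_isGeodesic
  thin := by
    intro p q r α β hα hβ p' q' r' hpq hpr hqr s hs t ht x' hx' y' hy' hsx hty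
    rw [segment_eq_image] at hx' hy'
    obtain ⟨a, ha, rfl⟩ := hx'
    obtain ⟨b, hb, rfl⟩ := hy'
    have hdist : ∀ (c : ℝ) (w : EuclideanSpace ℝ (Fin 2)), c ∈ Set.Icc (0 : ℝ) 1 →
        dist p' ((1 - c) • p' + c • w) = c * dist p' w := by
      intro c w hc
      have : p' - ((1 - c) • p' + c • w) = c • (p' - w) := by module
      rw [dist_eq_norm, this, norm_smul, Real.norm_of_nonneg hc.1, dist_eq_norm]
    simp only at hsx hty ⊢
    rw [hdist a q' ha, hpq] at hsx
    rw [hdist b r' hb, hpr] at hty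
    subst hsx hty
    refine abs_le_of_sq_le_sq' ?_ dist_nonneg |>.2
    -- The inequality is used twice, along `β` and then along `α` seen from `r`; in the comparison
    -- triangle both are equalities.
    have h1 := h.dist_sq_le_of_isGeodesic hβ hb (α (a * dist p q))
    have h2 := h.dist_sq_le_of_isGeodesic hα ha r
    have h3 := dist_sq_convexComb ((1 - a) • p' + a • q') p' r' b
    have h4 := dist_sq_convexComb r' p' q' a
    have h0 : (0 : ℝ) ∈ Set.Icc 0 (dist p q) := ⟨le_rfl, dist_nonneg⟩
    have h5 := hα.isometry _ hs _ h0
    rw [hα.source, sub_zero, abs_of_nonneg hs.1] at h5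
    rw [h3, dist_comm _ p', hdist a q' ha, hpq, hpr, dist_comm _ r', h4, dist_comm r' p',
      dist_comm r' q', hpr, hqr, hpq]
    rw [h5, dist_comm (α _) r] at h1
    rw [dist_comm r p, dist_comm r q] at h2
    have h6 := mul_le_mul_of_nonneg_left h2 hb.1
    linarith

end CAT0

/-! ### The tree spanned by a `0`-hyperbolic space -/

/-- A `0`-hyperbolic pseudometric: one that satisfies the four-point condition. -/
structure IsTreeMetric {V : Type*} (d : V → V → ℝ) : Prop where
  self : ∀ x, d x x = 0
  symm : ∀ x y, d x y = d y x
  four_point : ∀ x y z w, d x y + d z w ≤ max (d x z + d y w) (d x w + d y z)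

/-- The point on the segment from `fst` to `snd` at distance `a` from `fst` and `b` from `snd`. -/
structure TreePoint {V : Type*} {d : V → V → ℝ} (hd : IsTreeMetric d) where
  /-- The first end point. -/
  fst : V
  /-- The second end point. -/
  snd : V
  /-- The distance from the first end point. -/
  a : ℝ
  /-- The distance from the second end point. -/
  b : ℝ
  a_nonneg : 0 ≤ a
  b_nonneg : 0 ≤ b
  add_eq : a + b = d fst snd

theorem IsTreeMetric.triangle {V : Type*} {d : V → V → ℝ} (hd : IsTreeMetric d) (x y z : V) :
    d x z ≤ d x y + d y z := by
  have := hd.four_point x z y y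
  rw [hd.self, max_self, hd.symm z y] at this
  linarith

namespace TreePoint

variable {V : Type*} {d : V → V → ℝ} {hd : IsTreeMetric d}

/-- The distance from a point on a segment to a point of the original space. -/
def toVertex (x : TreePoint hd) (w : V) : ℝ :=
  max (d x.fst w - x.a) (d x.snd w - x.b)

/-- The distance between two points on segments. -/
def distFun (x y : TreePoint hd) : ℝ :=
  max (y.toVertex x.fst - x.a) (y.toVertex x.snd - x.b)

/-- In a tree, two points on segments are joined by a path that extends to a path between suitable
end points of these segments; the other choices of end points only give lower bounds. Hence the
maximum. -/
theorem distFun_eq (x y : TreePoint hd) : distFun x y =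
    max (max (d x.fst y.fst - x.a - y.a) (d x.fst y.snd - x.a - y.b))
      (max (d x.snd y.fst - x.b - y.a) (d x.snd y.snd - x.b - y.b)) := by
  simp only [distFun, toVertex, hd.symm y.fst, hd.symm y.snd, ← max_sub_sub_right,
    sub_right_comm]

theorem distFun_self (x : TreePoint hd) : distFun x x = 0 := by
  have h1 := x.a_nonneg
  have h2 := x.b_nonneg
  have h3 := x.add_eq
  have h4 := hd.symm x.fst x.snd
  rw [distFun_eq, hd.self, hd.self]
  apply le_antisymm
  · refine max_le (max_le ?_ ?_) (max_le ?_ ?_) <;> linarith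
  · refine le_max_of_le_left (le_max_of_le_right ?_)
    linarith

theorem distFun_comm (x y : TreePoint hd) : distFun x y = distFun y x := by
  rw [distFun_eq, distFun_eq, hd.symm y.fst, hd.symm y.fst, hd.symm y.snd, hd.symm y.snd,
    max_max_max_comm]
  simp only [sub_right_comm]

/-- Extends the four-point condition from the two end points of a segment to a point on it, the
other three points being fixed. Using it for one point after another carries the condition from
vertices to all tree points. -/
theorem four_point_aux {a b p q r p' q' r' A B C : ℝ}
    (h1 : p + A ≤ max (q + B) (r + C)) (h2 : p' + A ≤ max (q' + B) (r' + C)) :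
    max (p - a) (p' - b) + A ≤ max (max (q - a) (q' - b) + B) (max (r - a) (r' - b) + C) := by
  have e1 := le_max_left (q - a) (q' - b)
  have e2 := le_max_right (q - a) (q' - b)
  have e3 := le_max_left (r - a) (r' - b)
  have e4 := le_max_right (r - a) (r' - b)
  rcases max_choice (p - a) (p' - b) with h | h <;> rw [h]
  · rcases le_max_iff.1 h1 with h | h
    · exact le_max_of_le_left (by linarith)
    · exact le_max_of_le_right (by linarith)
  · rcases le_max_iff.1 h2 with h | h
    · exact le_max_of_le_left (by linarith)
    · exact le_max_of_le_right (by linarith)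

theorem four_point_one (x : TreePoint hd) (u v w : V) :
    x.toVertex u + d v w ≤ max (x.toVertex v + d u w) (x.toVertex w + d u v) :=
  four_point_aux (hd.four_point _ u v w) (hd.four_point _ u v w)

theorem four_point_two (x y : TreePoint hd) (u v : V) :
    distFun x y + d u v ≤ max (x.toVertex u + y.toVertex v) (x.toVertex v + y.toVertex u) := by
  have key (w : V) : y.toVertex w + d u v ≤ max (d w u + y.toVertex v) (d w v + y.toVertex u) := by
    have := four_point_one y w u v
    rwa [max_comm, add_comm (y.toVertex u), add_comm (y.toVertex v)] at this
  exact four_point_aux (key _) (key _)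

/-- With two tree points and two vertices the condition is no longer symmetric: here the tree points
are separated on the left side, in `four_point_two` they are paired. -/
theorem four_point_two' (x y : TreePoint hd) (u v : V) :
    x.toVertex u + y.toVertex v ≤ max (distFun x y + d u v) (x.toVertex v + y.toVertex u) := by
  have key (w : V) : d w u + y.toVertex v ≤ max (y.toVertex w + d u v) (d w v + y.toVertex u) := by
    have := four_point_one y v u w
    rw [hd.symm v w, hd.symm v u, hd.symm u w] at this
    rw [add_comm, max_comm]
    rwa [add_comm (y.toVertex u)] at this
  exact four_point_aux (key _) (key _)

theorem four_point_three (x y z : TreePoint hd) (w : V) :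
    distFun x y + z.toVertex w ≤
      max (distFun x z + y.toVertex w) (x.toVertex w + distFun y z) := by
  have key (u : V) : y.toVertex u + z.toVertex w ≤
      max (z.toVertex u + y.toVertex w) (d u w + distFun y z) := by
    have := four_point_two' y z u w
    rw [max_comm, add_comm (distFun y z)] at this
    rwa [add_comm (z.toVertex u)]
  exact four_point_aux (key _) (key _)

theorem four_point (x y z w : TreePoint hd) :
    distFun x y + distFun z w ≤ max (distFun x z + distFun y w) (distFun x w + distFun y z) := by
  have key (u : V) : y.toVertex u + distFun z w ≤
      max (z.toVertex u + distFun y w) (w.toVertex u + distFun y z) := by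
    have := four_point_three z w y u
    rw [distFun_comm z y, distFun_comm w y] at this
    rwa [add_comm, max_comm, add_comm (w.toVertex u)]
  exact four_point_aux (key _) (key _)

theorem distFun_isTreeMetric : IsTreeMetric (distFun (hd := hd)) :=
  ⟨distFun_self, distFun_comm, four_point⟩

noncomputable instance : PseudoMetricSpace (TreePoint hd) where
  dist := distFun
  dist_self := distFun_self
  dist_comm := distFun_comm
  dist_triangle := distFun_isTreeMetric.triangle

theorem dist_eq (x y : TreePoint hd) : dist x y =
    max (max (d x.fst y.fst - x.a - y.a) (d x.fst y.snd - x.a - y.b))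
      (max (d x.snd y.fst - x.b - y.a) (d x.snd y.snd - x.b - y.b)) :=
  distFun_eq x y

/-- A point of the original space as a point of the tree. -/
def ofVertex (w : V) : TreePoint hd := ⟨w, w, 0, 0, le_rfl, le_rfl, by rw [hd.self, add_zero]⟩

theorem distFun_ofVertex (x : TreePoint hd) (w : V) : distFun x (ofVertex w) = x.toVertex w := by
  simp only [distFun, toVertex, ofVertex, sub_zero, max_self, hd.symm w]

theorem exists_between (x y : TreePoint hd) {r s : ℝ} (hr : 0 ≤ r) (hs : 0 ≤ s)
    (hrs : r + s = dist x y) : ∃ m : TreePoint hd, dist x m ≤ r ∧ dist y m ≤ s := by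
  -- End points `p` and `q` realising the maximum: `x` and `y` then behave like points of the
  -- segment from `p` to `q`, and `m` is taken on it.
  have key : ∃ p q : V, ∃ a b : ℝ, 0 ≤ a ∧ 0 ≤ b ∧ dist x y = d p q - a - b ∧
      x.toVertex p = a ∧ y.toVertex q = b := by
    have e1 : x.toVertex x.fst = x.a := by
      have := x.a_nonneg
      rw [toVertex, hd.self, hd.symm, ← x.add_eq, max_eq_right] <;> linarith
    have e2 : x.toVertex x.snd = x.b := by
      have := x.b_nonneg
      rw [toVertex, hd.self, ← x.add_eq, max_eq_left] <;> linarith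
    have e3 : y.toVertex y.fst = y.a := by
      have := y.a_nonneg
      rw [toVertex, hd.self, hd.symm, ← y.add_eq, max_eq_right] <;> linarith
    have e4 : y.toVertex y.snd = y.b := by
      have := y.b_nonneg
      rw [toVertex, hd.self, ← y.add_eq, max_eq_left] <;> linarith
    rw [dist_eq]
    rcases max_choice (max (d x.fst y.fst - x.a - y.a) (d x.fst y.snd - x.a - y.b))
      (max (d x.snd y.fst - x.b - y.a) (d x.snd y.snd - x.b - y.b)) with h | h <;> rw [h]
    · rcases max_choice (d x.fst y.fst - x.a - y.a) (d x.fst y.snd - x.a - y.b) with h | h <;>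
        rw [h]
      · exact ⟨_, _, _, _, x.a_nonneg, y.a_nonneg, rfl, e1, e3⟩
      · exact ⟨_, _, _, _, x.a_nonneg, y.b_nonneg, rfl, e1, e4⟩
    · rcases max_choice (d x.snd y.fst - x.b - y.a) (d x.snd y.snd - x.b - y.b) with h | h <;>
        rw [h]
      · exact ⟨_, _, _, _, x.b_nonneg, y.a_nonneg, rfl, e2, e3⟩
      · exact ⟨_, _, _, _, x.b_nonneg, y.b_nonneg, rfl, e2, e4⟩
  obtain ⟨p, q, a, b, ha, hb, hxy, hp, hq⟩ := key
  have tri (u v : TreePoint hd) (w : V) : u.toVertex w ≤ dist u v + v.toVertex w := by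
    rw [← distFun_ofVertex, ← distFun_ofVertex]
    exact dist_triangle u v (ofVertex w)
  refine ⟨⟨p, q, a + r, s + b, by linarith, by linarith, by linarith⟩, ?_, ?_⟩
  · rw [dist_comm]
    change max (x.toVertex p - _) (x.toVertex q - _) ≤ _
    have := tri x y q
    refine max_le ?_ ?_ <;> linarith
  · rw [dist_comm]
    change max (y.toVertex p - _) (y.toVertex q - _) ≤ _
    have := tri y x p
    rw [dist_comm] at this
    refine max_le ?_ ?_ <;> linarith

theorem hasCN : HasCN (TreePoint hd) := by
  intro y z t ht
  obtain ⟨m, hy, hz⟩ := exists_between y z (mul_nonneg ht.1 dist_nonneg)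
    (mul_nonneg (sub_nonneg.2 ht.2) dist_nonneg) (r := t * dist y z) (s := (1 - t) * dist y z)
    (by ring)
  refine ⟨m, fun x => ?_⟩
  -- Whichever term is the maximum, `m` lies between `x` and one of `y`, `z`; the triangle
  -- inequality controls the other.
  have h4 : dist x m + dist y z ≤ max (dist x y + dist m z) (dist x z + dist m y) :=
    four_point x m y z
  rw [dist_comm y m] at hy
  rw [dist_comm z m] at hz
  have t1 := dist_triangle x y z
  have t2 := dist_triangle x z y
  have t3 := dist_triangle y x z
  rw [dist_comm z y] at t2
  rw [dist_comm y x] at t3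
  have hx : (0 : ℝ) ≤ dist x m := dist_nonneg
  rcases le_max_iff.1 h4 with h | h
  · have h5 : dist x m ≤ dist x y - t * dist y z := by linarith
    have h6 : dist x m ^ 2 ≤ (dist x y - t * dist y z) ^ 2 := pow_le_pow_left₀ hx h5 2
    have h7 : (dist x y - dist y z) ^ 2 ≤ dist x z ^ 2 :=
      sq_le_sq' (by linarith) (by linarith)
    have h8 := mul_le_mul_of_nonneg_left h7 ht.1
    linarith
  · have h5 : dist x m ≤ dist x z - (1 - t) * dist y z := by linarith
    have h6 : dist x m ^ 2 ≤ (dist x z - (1 - t) * dist y z) ^ 2 := pow_le_pow_left₀ hx h5 2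
    have h7 : (dist x z - dist y z) ^ 2 ≤ dist x y ^ 2 :=
      sq_le_sq' (by linarith) (by linarith)
    have h8 := mul_le_mul_of_nonneg_left h7 (sub_nonneg.2 ht.2)
    linarith

end TreePoint

/-! ### Reduced forms in amalgamated products -/

section ReducedForm

variable {ι K : Type*} [Group K]

/-- `ReducedForm S C g l` means that `g` is a product of elements of the subgroups `S i` and of an
element of `C`, where the former elements do not lie in `C` and where `l` is the list of their
indices, in which neighbours are distinct. -/
inductive ReducedForm (S : ι → Subgroup K) (C : Subgroup K) : K → List ι → Prop
  | of_mem {c : K} (hc : c ∈ C) : ReducedForm S C c []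
  | cons {i : ι} {x g : K} {l : List ι} (hx : x ∈ S i) (hxC : x ∉ C) (hl : l.head? ≠ some i)
      (hg : ReducedForm S C g l) : ReducedForm S C (x * g) (i :: l)

/-- `K` is the free product of the subgroups `S i` amalgamated along `C`. -/
structure IsAmalgam (S : ι → Subgroup K) (C : Subgroup K) : Prop where
  le : ∀ i, C ≤ S i
  iSup_eq_top : ⨆ i, S i = ⊤
  eq_nil : ∀ l, ReducedForm S C 1 l → l = []

variable {S : ι → Subgroup K} {C : Subgroup K}

namespace ReducedForm

theorem mul_left (hA : IsAmalgam S C) {c g : K} {l : List ι} (hc : c ∈ C)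
    (hg : ReducedForm S C g l) : ReducedForm S C (c * g) l := by
  cases hg with
  | of_mem h => exact .of_mem (C.mul_mem hc h)
  | @cons i x g l hx hxC hl hg =>
    rw [← mul_assoc]
    exact .cons ((S i).mul_mem (hA.le i hc) hx) (fun h => hxC ((C.mul_mem_cancel_left hc).1 h)) hl
      hg

theorem exists_mul (hA : IsAmalgam S C) {i : ι} {x g : K} {l : List ι} (hx : x ∈ S i)
    (hg : ReducedForm S C g l) : ∃ m, ReducedForm S C (x * g) m ∧ m.length ≤ l.length + 1 := by
  by_cases hxC : x ∈ C
  · exact ⟨l, hg.mul_left hA hxC, by omega⟩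
  cases hg with
  | of_mem h => exact ⟨[i], .cons hx hxC (by simp) (.of_mem h), le_rfl⟩
  | @cons j y g l hy hyC hl hg =>
    by_cases hij : j = i
    · subst hij
      rw [← mul_assoc]
      by_cases hxy : x * y ∈ C
      · exact ⟨l, hg.mul_left hA hxy, by rw [List.length_cons]; omega⟩
      · exact ⟨j :: l, .cons ((S j).mul_mem hx hy) hxy hl hg, by simp⟩
    · exact ⟨i :: j :: l, .cons hx hxC (by simpa using hij) (.cons hy hyC hl hg), le_rfl⟩

theorem exists_form (hA : IsAmalgam S C) (g : K) : ∃ l, ReducedForm S C g l := by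
  have key : ∀ h l, ReducedForm S C h l → ∃ m, ReducedForm S C (g * h) m := by
    have hg : g ∈ ⨆ i, S i := hA.iSup_eq_top ▸ Subgroup.mem_top g
    refine Subgroup.iSup_induction S
      (C := fun g => ∀ h l, ReducedForm S C h l → ∃ m, ReducedForm S C (g * h) m) hg ?_ ?_ ?_
    · intro i x hx h l hl
      obtain ⟨m, hm, -⟩ := hl.exists_mul hA hx
      exact ⟨m, hm⟩
    · exact fun h l hl => ⟨l, by rwa [one_mul]⟩
    · intro x y hx hy h l hl
      obtain ⟨m, hm⟩ := hy h l hl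
      rw [mul_assoc]
      exact hx _ m hm
  simpa using key 1 [] (.of_mem C.one_mem)

/-- First syllables from different factors neither cancel nor merge at the junction. -/
theorem inv_mul (hA : IsAmalgam S C) {g : K} {l : List ι} (hg : ReducedForm S C g l) :
    ∀ {h : K} {m : List ι}, ReducedForm S C h m → (∀ i, l.head? = some i → m.head? ≠ some i) →
      ReducedForm S C (g⁻¹ * h) (l.reverse ++ m) := by
  induction hg with
  | of_mem hc => exact fun hh _ => hh.mul_left hA (C.inv_mem hc)
  | @cons i x g l hx hxC hl hg ih =>
    intro h m hh hm
    have h1 : ReducedForm S C (x⁻¹ * h) (i :: m) :=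
      .cons ((S i).inv_mem hx) (fun h => hxC (C.inv_mem_iff.1 h)) (hm i rfl) hh
    have h2 := ih h1 (fun j hj hij => hl (hj.trans hij.symm))
    simpa [mul_assoc] using h2

/-- First syllables from the same factor, in different cosets of `C`, merge into the one syllable
`x⁻¹ y`. -/
theorem mul_inv_mul (hA : IsAmalgam S C) {i : ι} {x y g h : K} {l m : List ι} (hx : x ∈ S i)
    (hy : y ∈ S i) (hxy : x⁻¹ * y ∉ C) (hg : ReducedForm S C g l) (hl : l.head? ≠ some i)
    (hh : ReducedForm S C h m) (hm : m.head? ≠ some i) :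
    ReducedForm S C ((x * g)⁻¹ * (y * h)) (l.reverse ++ i :: m) := by
  have h1 : ReducedForm S C (x⁻¹ * y * h) (i :: m) :=
    .cons ((S i).mul_mem ((S i).inv_mem hx) hy) hxy hm hh
  have h2 := hg.inv_mul hA h1 (fun j hj hij => hl (hj.trans hij.symm))
  simpa [mul_assoc] using h2

/-- Two forms of `g` combine to a form of `g⁻¹ g = 1`, which must be empty; so the first syllables
lie in the same coset of `C` and can be stripped. -/
theorem unique (hA : IsAmalgam S C) {g : K} {l : List ι} (hg : ReducedForm S C g l) :
    ∀ {m : List ι}, ReducedForm S C g m → l = m := by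
  induction hg with
  | of_mem hc =>
    intro m hm
    have := hm.mul_left hA (C.inv_mem hc)
    rw [inv_mul_cancel] at this
    exact (hA.eq_nil m this).symm
  | @cons i x g l hx hxC hl hg ih =>
    intro m hm
    generalize hk : x * g = k at hm
    cases hm with
    | of_mem hc =>
      have := (ReducedForm.cons hx hxC hl hg).mul_left hA (C.inv_mem hc)
      rw [← hk, inv_mul_cancel] at this
      exact hA.eq_nil _ this
    | @cons j y h m hy hyC hm hh =>
      by_cases hij : i = j
      · subst hij
        by_cases hxy : x⁻¹ * y ∈ C
        · have := hh.mul_left hA hxy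
          rw [mul_assoc, ← hk, inv_mul_cancel_left] at this
          rw [ih this]
        · have := mul_inv_mul hA hx hy hxy hg hl hh hm
          rw [hk, inv_mul_cancel] at this
          simpa using hA.eq_nil _ this
      · have := (ReducedForm.cons hx hxC hl hg).inv_mul hA (.cons hy hyC hm hh) (by
          simpa using Ne.symm hij)
        rw [hk, inv_mul_cancel] at this
        simpa using hA.eq_nil _ this

end ReducedForm

/-! ### The syllable length and its four-point condition -/

variable (S C) in
/-- The number of factors outside `C` in a reduced form. -/
noncomputable def reducedLength (g : K) : ℕ :=
  sInf {n | ∃ l, ReducedForm S C g l ∧ l.length = n}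

theorem ReducedForm.length_eq (hA : IsAmalgam S C) {g : K} {l : List ι}
    (hg : ReducedForm S C g l) : reducedLength S C g = l.length := by
  have : {n | ∃ l, ReducedForm S C g l ∧ l.length = n} = {l.length} := by
    ext n
    constructor
    · rintro ⟨m, hm, rfl⟩
      rw [hg.unique hA hm, Set.mem_singleton_iff]
    · rintro rfl
      exact ⟨l, hg, rfl⟩
  rw [reducedLength, this, csInf_singleton]

namespace IsAmalgam

variable (hA : IsAmalgam S C)
include hA

theorem length_of_mem {c : K} (hc : c ∈ C) : reducedLength S C c = 0 :=
  (ReducedForm.of_mem hc).length_eq hA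

theorem mem_of_length {g : K} (hg : reducedLength S C g = 0) : g ∈ C := by
  obtain ⟨l, hl⟩ := ReducedForm.exists_form hA g
  rw [hl.length_eq hA, List.length_eq_zero_iff] at hg
  subst hg
  cases hl
  assumption

theorem length_mul_left {c : K} (hc : c ∈ C) (g : K) :
    reducedLength S C (c * g) = reducedLength S C g := by
  obtain ⟨l, hl⟩ := ReducedForm.exists_form hA g
  rw [hl.length_eq hA, (hl.mul_left hA hc).length_eq hA]

theorem length_inv (g : K) : reducedLength S C g⁻¹ = reducedLength S C g := by
  obtain ⟨l, hl⟩ := ReducedForm.exists_form hA g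
  have := hl.inv_mul hA (.of_mem C.one_mem) (by simp)
  rw [mul_one] at this
  rw [hl.length_eq hA, this.length_eq hA]
  simp

theorem length_mul_right {c : K} (hc : c ∈ C) (g : K) :
    reducedLength S C (g * c) = reducedLength S C g := by
  rw [← hA.length_inv, mul_inv_rev, hA.length_mul_left (C.inv_mem hc), hA.length_inv]

theorem length_mem_mul_le {i : ι} {x : K} (hx : x ∈ S i) (g : K) :
    reducedLength S C (x * g) ≤ reducedLength S C g + 1 := by
  obtain ⟨l, hl⟩ := ReducedForm.exists_form hA g
  obtain ⟨m, hm, hlm⟩ := hl.exists_mul hA hx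
  rwa [hl.length_eq hA, hm.length_eq hA]

theorem length_mul_le (g h : K) :
    reducedLength S C (g * h) ≤ reducedLength S C g + reducedLength S C h := by
  obtain ⟨l, hl⟩ := ReducedForm.exists_form hA g
  rw [hl.length_eq hA]
  induction hl with
  | of_mem hc => rw [hA.length_mul_left hc]; omega
  | @cons i x g l hx _ _ hg ih =>
    rw [mul_assoc, List.length_cons]
    have := hA.length_mem_mul_le hx (g * h)
    omega

theorem length_trichotomy {i j : ι} {x y g h : K} {l m : List ι} (hx : x ∈ S i) (hxC : x ∉ C)
    (hl : l.head? ≠ some i) (hg : ReducedForm S C g l) (hy : y ∈ S j) (hyC : y ∉ C)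
    (hm : m.head? ≠ some j) (hh : ReducedForm S C h m) :
    (i ≠ j ∧ reducedLength S C ((x * g)⁻¹ * (y * h)) = l.length + m.length + 2) ∨
    (i = j ∧ x⁻¹ * y ∉ C ∧ reducedLength S C ((x * g)⁻¹ * (y * h)) = l.length + m.length + 1) ∨
    (i = j ∧ x⁻¹ * y ∈ C) := by
  by_cases hij : i = j
  · subst hij
    by_cases hxy : x⁻¹ * y ∈ C
    · exact Or.inr (Or.inr ⟨rfl, hxy⟩)
    · refine Or.inr (Or.inl ⟨rfl, hxy, ?_⟩)
      rw [(ReducedForm.mul_inv_mul hA hx hy hxy hg hl hh hm).length_eq hA]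
      simp
      omega
  · refine Or.inl ⟨hij, ?_⟩
    rw [((ReducedForm.cons hx hxC hl hg).inv_mul hA (.cons hy hyC hm hh) (by
      simpa using Ne.symm hij)).length_eq hA]
    simp
    omega

/-- The four-point condition for `1, g, h, k`. Unless the first syllables of all three elements lie
in one coset of `C`, the lengths given by `length_trichotomy` and subadditivity decide. -/
theorem length_four_point_aux {g : K} {l : List ι} (hg : ReducedForm S C g l) :
    ∀ {h k : K} {m n : List ι}, ReducedForm S C h m → ReducedForm S C k n →
      reducedLength S C (g⁻¹ * h) + reducedLength S C k
        ≤ max (reducedLength S C (g⁻¹ * k) + reducedLength S C h)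
          (reducedLength S C (h⁻¹ * k) + reducedLength S C g) := by
  induction hg with
  | of_mem hc =>
    intro h k m n _ _
    rw [hA.length_mul_left (C.inv_mem hc), hA.length_mul_left (C.inv_mem hc)]
    exact le_max_of_le_left (by omega)
  | @cons i x g l hx hxC hl hg ih =>
    intro h k m n hh hk
    cases hh with
    | of_mem hc =>
      rw [hA.length_mul_right hc, hA.length_mul_left (C.inv_mem hc), hA.length_inv]
      exact le_max_of_le_right (by omega)
    | @cons j y h m hy hyC hm hh =>
      cases hk with
      | of_mem hc =>
        have := hA.length_mul_le (x * g)⁻¹ (y * h)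
        rw [hA.length_inv] at this
        rw [hA.length_mul_right hc, hA.length_mul_right hc, hA.length_inv, hA.length_inv,
          hA.length_of_mem hc]
        exact le_max_of_le_left (by omega)
      | @cons o z k n hz hzC hn hk =>
        have e1 := (ReducedForm.cons hx hxC hl hg).length_eq hA
        have e2 := (ReducedForm.cons hy hyC hm hh).length_eq hA
        have e3 := (ReducedForm.cons hz hzC hn hk).length_eq hA
        simp only [List.length_cons] at e1 e2 e3
        rw [e1, e2, e3]
        have t1 := hA.length_trichotomy hx hxC hl hg hy hyC hm hh
        have t2 := hA.length_trichotomy hx hxC hl hg hz hzC hn hk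
        have t3 := hA.length_trichotomy hy hyC hm hh hz hzC hn hk
        rw [le_max_iff]
        rcases t1 with ⟨h1, t1⟩ | ⟨h1, hxy, t1⟩ | ⟨h1, hxy⟩
        · rcases t2 with ⟨h2, t2⟩ | ⟨h2, hxz, t2⟩ | ⟨h2, hxz⟩
          · omega
          all_goals
            rcases t3 with ⟨h3, t3⟩ | ⟨h3, hyz, t3⟩ | ⟨h3, hyz⟩
            · omega
            all_goals exact absurd (h2.trans h3.symm) h1
        · rcases t2 with ⟨h2, t2⟩ | ⟨h2, hxz, t2⟩ | ⟨h2, hxz⟩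
          · omega
          · omega
          · rcases t3 with ⟨h3, t3⟩ | ⟨h3, hyz, t3⟩ | ⟨h3, hyz⟩
            · omega
            · omega
            · refine absurd ?_ hxy
              have := C.mul_mem hxz (C.inv_mem hyz)
              rwa [mul_inv_rev, inv_inv, mul_assoc, mul_inv_cancel_left] at this
        · subst h1
          have e4 : (x * g)⁻¹ * (y * h) = g⁻¹ * (x⁻¹ * y * h) := by group
          have hh' := hh.mul_left hA hxy
          have e5 := hA.length_mul_le g⁻¹ (x⁻¹ * y * h)
          rw [hA.length_inv, hg.length_eq hA, hh'.length_eq hA] at e5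
          rw [e4]
          rcases t2 with ⟨h2, t2⟩ | ⟨h2, hxz, t2⟩ | ⟨h2, hxz⟩
          · omega
          · omega
          · subst h2
            -- All three forms start in `x C`: translating by `x⁻¹` removes one syllable from each
            -- and keeps the mutual distances, so induction applies.
            have hk' := hk.mul_left hA hxz
            have e6 : (x * g)⁻¹ * (z * k) = g⁻¹ * (x⁻¹ * z * k) := by group
            have e7 : (y * h)⁻¹ * (z * k) = (x⁻¹ * y * h)⁻¹ * (x⁻¹ * z * k) := by group
            have := ih hh' hk'
            rw [hg.length_eq hA, hh'.length_eq hA, hk'.length_eq hA, le_max_iff] at this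
            rw [e6, e7]
            omega

theorem length_four_point (g h k : K) :
    reducedLength S C (g⁻¹ * h) + reducedLength S C k
        ≤ max (reducedLength S C (g⁻¹ * k) + reducedLength S C h)
          (reducedLength S C (h⁻¹ * k) + reducedLength S C g) := by
  obtain ⟨l, hl⟩ := ReducedForm.exists_form hA g
  obtain ⟨m, hm⟩ := ReducedForm.exists_form hA h
  obtain ⟨n, hn⟩ := ReducedForm.exists_form hA k
  exact hA.length_four_point_aux hl hm hn

theorem isTreeMetric :
    IsTreeMetric fun g h : K => (reducedLength S C (g⁻¹ * h) : ℝ) where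
  self x := by rw [inv_mul_cancel, hA.length_of_mem C.one_mem, Nat.cast_zero]
  symm x y := by rw [← hA.length_inv, mul_inv_rev, inv_inv]
  four_point x y z w := by
    have h := hA.length_four_point (w⁻¹ * x) (w⁻¹ * y) (w⁻¹ * z)
    have e (u v : K) : (w⁻¹ * u)⁻¹ * (w⁻¹ * v) = u⁻¹ * v := by group
    have s (u : K) : reducedLength S C (w⁻¹ * u) = reducedLength S C (u⁻¹ * w) := by
      rw [← hA.length_inv, mul_inv_rev, inv_inv]
    rw [e, e, e, s, s, s, add_comm (reducedLength S C (y⁻¹ * z))] at h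
    exact_mod_cast h

/-- Locates the syllable `x` of `k` that the point at distance `s` from `1` lies on; this is how
tree points are moved to edges at `1`. -/
theorem exists_edge [Nonempty ι] (k : K) {s : ℝ} (hs : s ∈ Set.Icc 0 (reducedLength S C k : ℝ)) :
    ∃ i, ∃ g x h : K, x ∈ S i ∧ k = g * x * h ∧
      reducedLength S C k = reducedLength S C g + reducedLength S C x + reducedLength S C h ∧
      reducedLength S C g ≤ s ∧ s ≤ reducedLength S C g + reducedLength S C x := by
  obtain ⟨l, hl⟩ := ReducedForm.exists_form hA k
  have h1 : reducedLength S C 1 = 0 := hA.length_of_mem C.one_mem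
  induction hl generalizing s with
  | @of_mem c hc =>
    obtain ⟨i⟩ := ‹Nonempty ι›
    rw [hA.length_of_mem hc, Nat.cast_zero] at hs
    refine ⟨i, 1, 1, c, (S i).one_mem, by group, ?_, ?_⟩
    · rw [h1]; omega
    · rw [h1, Nat.cast_zero]
      exact ⟨hs.1, by linarith [hs.2]⟩
  | @cons i x g l hx hxC hl hg ih =>
    have e1 := (ReducedForm.cons hx hxC hl hg).length_eq hA
    have e2 := hg.length_eq hA
    have e3 : reducedLength S C x = 1 := by
      have := (ReducedForm.cons hx hxC (by simp) (.of_mem C.one_mem) :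
        ReducedForm S C (x * 1) [i]).length_eq hA
      rwa [mul_one] at this
    rw [List.length_cons, ← e2] at e1
    rcases le_total s 1 with h | h
    · refine ⟨i, 1, x, g, hx, by group, by omega, ?_⟩
      rw [h1, e3]
      push_cast
      exact ⟨hs.1, by linarith⟩
    · have hs' : s - 1 ∈ Set.Icc 0 (reducedLength S C g : ℝ) := by
        rw [e1] at hs
        push_cast at hs
        exact ⟨by linarith, by linarith [hs.2]⟩
      obtain ⟨j, g1, y, g2, hy, rfl, e4, e5, e6⟩ := ih hs'
      have e7 := hA.length_mem_mul_le hx g1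
      have e8 := hA.length_mul_le (x * g1 * y) g2
      have e9 := hA.length_mul_le (x * g1) y
      have e10 : x * (g1 * y * g2) = x * g1 * y * g2 := by group
      rw [e10] at e1
      have e11 : reducedLength S C (x * g1) = reducedLength S C g1 + 1 := by omega
      refine ⟨j, x * g1, y, g2, hy, e10, by rw [e10]; omega, ?_⟩
      rw [e11]
      push_cast
      constructor <;> linarith

/-- Local finiteness of the tree: a first syllable `x = r c` contributes finitely many `r`, and `c ∈
C` is absorbed by the rest of the word without changing its length. -/
theorem finite_cosets [Finite ι]
    (hfin : ∀ i, ∃ F : Set K, F.Finite ∧ ∀ x ∈ S i, ∃ r ∈ F, r⁻¹ * x ∈ C) (n : ℕ) :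
    ∃ F : Set K, F.Finite ∧ ∀ g, reducedLength S C g ≤ n → ∃ r ∈ F, r⁻¹ * g ∈ C := by
  choose F hF hFS using hfin
  induction n with
  | zero =>
    refine ⟨{1}, Set.finite_singleton 1, fun g hg => ⟨1, rfl, ?_⟩⟩
    rw [inv_one, one_mul]
    exact hA.mem_of_length (Nat.le_zero.1 hg)
  | succ n ih =>
    obtain ⟨E, hE, hES⟩ := ih
    refine ⟨E ∪ ⋃ i, Set.image2 (· * ·) (F i) E,
      hE.union (Set.finite_iUnion fun i => (hF i).image2 _ hE), fun g hg => ?_⟩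
    obtain ⟨l, hl⟩ := ReducedForm.exists_form hA g
    cases hl with
    | of_mem hc =>
      obtain ⟨r, hr, hrg⟩ := hES g (by rw [hA.length_of_mem hc]; omega)
      exact ⟨r, Or.inl hr, hrg⟩
    | @cons i x g l hx hxC hl hg' =>
      obtain ⟨r, hr, hrx⟩ := hFS i x hx
      have e1 := (ReducedForm.cons hx hxC hl hg').length_eq hA
      have e2 := (hg'.mul_left hA hrx).length_eq hA
      rw [List.length_cons] at e1
      obtain ⟨r', hr', hrg⟩ := hES (r⁻¹ * x * g) (by omega)
      refine ⟨r * r', Or.inr (Set.mem_iUnion.2 ⟨i, r, hr, r', hr', rfl⟩), ?_⟩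
      rwa [mul_inv_rev, mul_assoc, ← mul_assoc r⁻¹]

end IsAmalgam

end ReducedForm

/-! ### Groups with a subgroup of index two -/

section IndexTwo

theorem exists_eq_mul_of_index_two {N H : Type*} [Group N] [Group H] {ι : N →* H}
    (hι : ι.range.index = 2) {h : H} (hh : h ∉ ι.range) (x : H) :
    (∃ n, x = ι n) ∨ ∃ n, x = ι n * h := by
  by_cases hx : x ∈ ι.range
  · obtain ⟨n, rfl⟩ := hx
    exact Or.inl ⟨n, rfl⟩
  · have : x * h⁻¹ ∈ ι.range := by
      rw [Subgroup.mul_mem_iff_of_index_two hι, inv_mem_iff]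
      tauto
    obtain ⟨n, hn⟩ := this
    exact Or.inr ⟨n, by rw [hn, inv_mul_cancel_right]⟩

/-- `H` is generated by `N` and `h` subject to the value of `h²` and the conjugation action of `h`;
these are the only relations to check. -/
theorem exists_lift_of_index_two {N H P : Type*} [Group N] [Group H] [Group P] {ι : N →* H}
    (hinj : Function.Injective ι) (hι : ι.range.index = 2) {h : H} (hh : h ∉ ι.range)
    (φ : N →* P) (m : P) (hsq : ∀ n, ι n = h * h → φ n = m * m)
    (hconj : ∀ n n', h * ι n * h⁻¹ = ι n' → m * φ n * m⁻¹ = φ n') :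
    ∃ Φ : H →* P, (∀ n, Φ (ι n) = φ n) ∧ Φ h = m := by
  have hnormal := Subgroup.normal_of_index_eq_two hι
  have hex : ∀ x : H, ∃ p : P, (∀ n, x = ι n → p = φ n) ∧ ∀ n, x = ι n * h → p = φ n * m := by
    intro x
    rcases exists_eq_mul_of_index_two hι hh x with ⟨n, rfl⟩ | ⟨n, rfl⟩
    · refine ⟨φ n, fun n' hn' => by rw [hinj hn'], fun n' hn' => absurd ?_ hh⟩
      exact ⟨n'⁻¹ * n, by rw [map_mul, map_inv, hn', inv_mul_cancel_left]⟩
    · refine ⟨φ n * m, fun n' hn' => absurd ?_ hh, fun n' hn' => ?_⟩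
      · exact ⟨n⁻¹ * n', by rw [map_mul, map_inv, ← hn', inv_mul_cancel_left]⟩
      · rw [hinj (mul_right_cancel hn')]
  choose Φ h1 h2 using hex
  have h1' (n : N) : Φ (ι n) = φ n := h1 _ n rfl
  have h2' (n : N) : Φ (ι n * h) = φ n * m := h2 _ n rfl
  obtain ⟨a, ha⟩ : h * h ∈ ι.range := Subgroup.mul_self_mem_of_index_two hι h
  have hmul (x y : H) : Φ (x * y) = Φ x * Φ y := by
    rcases exists_eq_mul_of_index_two hι hh x with ⟨n, rfl⟩ | ⟨n, rfl⟩ <;>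
      rcases exists_eq_mul_of_index_two hι hh y with ⟨n', rfl⟩ | ⟨n', rfl⟩
    · rw [← map_mul, h1', h1', h1', map_mul]
    · rw [← mul_assoc, ← map_mul, h2', h2', h1', map_mul, mul_assoc]
    · obtain ⟨k, hk⟩ := hnormal.conj_mem (ι n') ⟨n', rfl⟩ h
      have e : ι n * h * ι n' = ι (n * k) * h := by rw [map_mul, hk]; group
      rw [e, h2', h2', h1', map_mul, ← hconj n' k hk.symm]
      group
    · obtain ⟨k, hk⟩ := hnormal.conj_mem (ι n') ⟨n', rfl⟩ h
      have e : ι n * h * (ι n' * h) = ι (n * k * a) := by rw [map_mul, map_mul, hk, ha]; group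
      rw [e, h1', h2', h2', map_mul, map_mul, ← hconj n' k hk.symm, hsq a ha]
      group
  refine ⟨MonoidHom.mk' Φ hmul, h1', ?_⟩
  have := h2' 1
  rwa [map_one, map_one, one_mul, one_mul] at this

/-- If `σ` is an endomorphism of `Γ` whose square is conjugation by the `σ`-fixed element `a`, then
`Γ` embeds in a group in which `σ` is conjugation by a square root of `a`. -/
theorem exists_square_root {Γ : Type*} [Group Γ] (σ : Γ →* Γ) (a : Γ) (ha : σ a = a)
    (hσ : ∀ x, σ (σ x) = a * x * a⁻¹) :
    ∃ (M : Γ →* Equiv.Perm (Γ × Bool)) (u : Equiv.Perm (Γ × Bool)), Function.Injective M ∧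
      u * u = M a ∧ ∀ x, u * M x * u⁻¹ = M (σ x) := by
  let M : Γ →* Equiv.Perm (Γ × Bool) :=
    { toFun := fun g => Equiv.prodCongr (Equiv.mulLeft g) (Equiv.refl Bool)
      map_one' := by ext x <;> simp
      map_mul' := fun g h => by ext x <;> simp [mul_assoc] }
  have hM (g : Γ) (x : Γ × Bool) : M g x = (g * x.1, x.2) := rfl
  -- Read `(x, false)` as `x` and `(x, true)` as `x u`; then `F` is left multiplication by `u`, from
  -- `u x = σ(x) u` and `u² = a`.
  let F : Γ × Bool → Γ × Bool := fun x => bif x.2 then (σ x.1 * a, false) else (σ x.1, true)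
  have hF0 (x : Γ) : F (x, false) = (σ x, true) := rfl
  have hF1 (x : Γ) : F (x, true) = (σ x * a, false) := rfl
  have hFF (x : Γ × Bool) : F (F x) = (a * x.1, x.2) := by
    rcases x with ⟨x, _ | _⟩
    · rw [hF0, hF1, hσ, inv_mul_cancel_right]
    · rw [hF1, hF0, map_mul, hσ, ha, inv_mul_cancel_right]
  have hFM (g : Γ) (x : Γ × Bool) : F (g * x.1, x.2) = (σ g * (F x).1, (F x).2) := by
    rcases x with ⟨x, _ | _⟩
    · rw [hF0, hF0, map_mul]
    · rw [hF1, hF1, map_mul, mul_assoc]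
  let u : Equiv.Perm (Γ × Bool) :=
    { toFun := F
      invFun := fun x => (a⁻¹ * (F x).1, (F x).2)
      left_inv := fun x => by simp [hFF]
      right_inv := fun x => by simp [hFM, hFF, ha] }
  have hu (x : Γ × Bool) : u x = F x := rfl
  refine ⟨M, u, fun g h hgh => ?_, ?_, fun g => ?_⟩
  · have := congrArg Prod.fst (Equiv.congr_fun hgh (1, false))
    simpa [hM] using this
  · refine Equiv.ext fun x => ?_
    rw [Equiv.Perm.mul_apply, hu, hu, hFF, hM]
  · rw [mul_inv_eq_iff_eq_mul]
    refine Equiv.ext fun x => ?_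
    rw [Equiv.Perm.mul_apply, Equiv.Perm.mul_apply, hu, hu, hM, hM, hFM]

/-- The semidirect product of `V` with `{±1}`; as `V` is abelian, every element of the nontrivial
coset acts in the same way. -/
theorem exists_indexTwoOvergroup {V : Type} [AddCommGroup V] (α : V →+ V)
    (hα : ∀ v, α (α v) = v) :
    ∃ (H : Type) (_ : Group H) (ι : Multiplicative V →* H), Function.Injective ι ∧
      ι.range.index = 2 ∧ ∀ h : H, h ∉ ι.range → ∀ v : V,
        h * ι (Multiplicative.ofAdd v) * h⁻¹ = ι (Multiplicative.ofAdd (α v)) := by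
  let e : MulAut (Multiplicative V) :=
    { toFun := AddMonoidHom.toMultiplicative α
      invFun := AddMonoidHom.toMultiplicative α
      left_inv := hα
      right_inv := hα
      map_mul' := map_mul _ }
  have he : e * e = 1 := MulEquiv.ext hα
  let θ : ℤˣ →* MulAut (Multiplicative V) :=
    { toFun := fun u => if u = 1 then 1 else e
      map_one' := if_pos rfl
      map_mul' := fun u w => by
        rcases Int.units_eq_one_or u with rfl | rfl <;>
          rcases Int.units_eq_one_or w with rfl | rfl <;> simp [he] }
  have hθ : θ (-1) = e := by
    change (if (-1 : ℤˣ) = 1 then 1 else e) = e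
    exact if_neg (by decide)
  have hmem (x : Multiplicative V ⋊[θ] ℤˣ) :
      x ∈ (SemidirectProduct.inl : Multiplicative V →* Multiplicative V ⋊[θ] ℤˣ).range ↔
        x.right = 1 := by
    rw [SemidirectProduct.range_inl_eq_ker_rightHom, MonoidHom.mem_ker]
    rfl
  refine ⟨Multiplicative V ⋊[θ] ℤˣ, inferInstance, SemidirectProduct.inl,
    SemidirectProduct.inl_injective, ?_, ?_⟩
  · refine Subgroup.index_eq_two_iff.2 ⟨SemidirectProduct.inr (-1), fun b => ?_⟩
    rw [hmem, hmem, SemidirectProduct.mul_right, SemidirectProduct.right_inr]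
    rcases Int.units_eq_one_or b.right with h | h <;> rw [h] <;> decide
  · intro h hh v
    rw [hmem] at hh
    have hh' : h.right = -1 := (Int.units_eq_one_or _).resolve_left hh
    rw [mul_inv_eq_iff_eq_mul]
    refine SemidirectProduct.ext ?_ ?_
    · simp only [SemidirectProduct.mul_left, SemidirectProduct.left_inl,
        SemidirectProduct.right_inl, hh', hθ, map_one, MulAut.one_apply]
      rw [mul_comm]
      rfl
    · simp

end IndexTwo

/-! ### Amalgams of two groups -/

namespace Amalgam

variable {C H H' : Type} [Group C] [Group H] [Group H'] {f : C →* H} {f' : C →* H'}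

theorem inl_eq_inr (c : C) : inl f f' (f c) = inr f f' (f' c) :=
  (Monoid.PushoutI.of_apply_eq_base (famHom f f') false c).trans
    (Monoid.PushoutI.of_apply_eq_base (famHom f f') true c).symm

theorem exists_lift {P : Type*} [Group P] (p : H →* P) (q : H' →* P)
    (hpq : ∀ c, p (f c) = q (f' c)) :
    ∃ Ψ : Amalgam f f' →* P, (∀ x, Ψ (inl f f' x) = p x) ∧ ∀ x, Ψ (inr f f' x) = q x := by
  let F : ∀ b, Fam H H' b →* P := fun b => match b with
    | false => p
    | true => q
  have hF : ∀ b, (F b).comp (famHom f f' b) = p.comp f := fun b => match b with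
    | false => rfl
    | true => MonoidHom.ext fun c => (hpq c).symm
  exact ⟨Monoid.PushoutI.lift F (p.comp f) hF,
    fun x => Monoid.PushoutI.lift_of F (p.comp f) hF (i := false) x,
    fun x => Monoid.PushoutI.lift_of F (p.comp f) hF (i := true) x⟩

theorem induction {p : Amalgam f f' → Prop} (hl : ∀ x, p (inl f f' x)) (hr : ∀ x, p (inr f f' x))
    (hmul : ∀ x y, p x → p y → p (x * y)) (x : Amalgam f f') : p x := by
  induction x using Monoid.PushoutI.induction_on with
  | of i g => exact match i, g with
    | false, g => hl g
    | true, g => hr g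
  | base c =>
    rw [← Monoid.PushoutI.of_apply_eq_base (famHom f f') false c]
    exact hl _
  | mul x y hx hy => exact hmul x y hx hy

end Amalgam

theorem ReducedForm.exists_word {ι : Type*} {G : ι → Type*} [∀ i, Group (G i)] {B : Type*}
    [Group B] {φ : ∀ i, B →* G i} {g : Monoid.PushoutI φ} {l : List ι}
    (hg : ReducedForm (fun i => (Monoid.PushoutI.of (φ := φ) i).range)
      (Monoid.PushoutI.base φ).range g l) :
    ∃ w : Monoid.CoprodI.Word G, Monoid.PushoutI.Reduced φ w ∧ w.toList.map Sigma.fst = l ∧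
      ∃ c ∈ (Monoid.PushoutI.base φ).range, g = Monoid.PushoutI.ofCoprodI w.prod * c := by
  induction hg with
  | @of_mem c hc =>
    exact ⟨.empty, fun g hg => by simp at hg, rfl, c, hc, by simp⟩
  | @cons i x g l hx hxC hl hg ih =>
    obtain ⟨w, hw, rfl, c, hc, rfl⟩ := ih
    obtain ⟨y, rfl⟩ := hx
    have hy : y ∉ (φ i).range := by
      rintro ⟨b, rfl⟩
      exact hxC ⟨b, (Monoid.PushoutI.of_apply_eq_base φ i b).symm⟩
    have hy1 : y ≠ 1 := by
      rintro rfl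
      exact hy (one_mem _)
    have hidx : w.fstIdx ≠ some i := by rwa [Monoid.CoprodI.Word.fstIdx, ← List.head?_map]
    refine ⟨.cons y w hidx hy1, ?_, rfl, c, hc, ?_⟩
    · intro g hg
      rcases List.mem_cons.1 hg with rfl | hg
      · exact hy
      · exact hw g hg
    · rw [Monoid.CoprodI.Word.prod_cons, map_mul, Monoid.PushoutI.ofCoprodI_of, mul_assoc]

/-- The substance is the normal form theorem `Reduced.eq_empty_of_mem_range`: a nonempty reduced
word does not lie in the amalgamated subgroup. -/
theorem isAmalgam_pushoutI {ι : Type*} [Nonempty ι] {G : ι → Type*} [∀ i, Group (G i)] {B : Type*}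
    [Group B] {φ : ∀ i, B →* G i} (hφ : ∀ i, Function.Injective (φ i)) :
    IsAmalgam (fun i => (Monoid.PushoutI.of (φ := φ) i).range) (Monoid.PushoutI.base φ).range where
  le i := by
    rintro _ ⟨b, rfl⟩
    exact ⟨φ i b, Monoid.PushoutI.of_apply_eq_base φ i b⟩
  iSup_eq_top := by
    refine eq_top_iff.2 fun x _ => ?_
    induction x using Monoid.PushoutI.induction_on with
    | of i g => exact Subgroup.mem_iSup_of_mem i ⟨g, rfl⟩
    | base b =>
      obtain ⟨i⟩ := ‹Nonempty ι›
      exact Subgroup.mem_iSup_of_mem i ⟨φ i b, Monoid.PushoutI.of_apply_eq_base φ i b⟩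
    | mul x y hx hy => exact mul_mem (hx trivial) (hy trivial)
  eq_nil l hl := by
    obtain ⟨w, hw, rfl, c, hc, hwc⟩ := hl.exists_word
    have : Monoid.PushoutI.ofCoprodI w.prod ∈ (Monoid.PushoutI.base φ).range := by
      rw [eq_inv_of_mul_eq_one_left hwc.symm]
      exact inv_mem hc
    rw [hw.eq_empty_of_mem_range hφ this]
    rfl

/-! ### The HNN-extension as a subgroup of index two -/

theorem index_range_eq_two {N P : Type*} [Group N] [Group P] {f : N →* P} {h : P}
    (χ : P →* ℤˣ) (hf : ∀ x, χ (f x) = 1) (hh : χ h = -1)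
    (hcov : ∀ k, k ∈ f.range ∨ k * h ∈ f.range) : f.range.index = 2 := by
  refine Subgroup.index_eq_two_iff.2 ⟨h, fun k => ?_⟩
  by_cases hk : k ∈ f.range
  · refine Or.inr ⟨hk, ?_⟩
    rintro ⟨x, hx⟩
    obtain ⟨y, rfl⟩ := hk
    have := congrArg χ hx
    rw [map_mul, hf, hf, hh] at this
    exact absurd this (by decide)
  · exact Or.inl ⟨(hcov k).resolve_left hk, hk⟩

section Embedding

variable {Λ D H H' : Type} [CommGroup Λ] [Group D] [Group H] [Group H'] {C B : Subgroup Λ}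

theorem exists_embedding (φ : C ≃* B) (j : D →* Λ) (hj : ∀ d, j d ∈ C) (hinj : Function.Injective j)
    (hsurj : ∀ c : C, ∃ d, j d = c) (ι : Λ →* H) (ι' : D →* H') (hι : Function.Injective ι)
    (hι' : Function.Injective ι') (hι2 : ι.range.index = 2) (hι2' : ι'.range.index = 2)
    (r : Λ →* Λ) (hr : ∀ v, r (r v) = v)
    (hconj : ∀ h, h ∉ ι.range → ∀ v, h * ι v * h⁻¹ = ι (r v))
    (hconj' : ∀ h, h ∉ ι'.range → ∀ d, ∃ d', j d' = r (φ ⟨j d, hj d⟩) ∧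
      h * ι' d * h⁻¹ = ι' d') :
    ∃ f : HNNExtension Λ C B φ →* Amalgam (ι.comp j) ι', Function.Injective f ∧
      f.range.index = 2 ∧ ∀ v, f (HNNExtension.of v) = Amalgam.inl _ _ (ι v) := by
  obtain ⟨h, hh⟩ : ∃ h, h ∉ ι.range := by
    by_contra! hall
    rw [(Subgroup.eq_top_iff' _).2 hall, Subgroup.index_top] at hι2
    omega
  obtain ⟨h', hh'⟩ : ∃ h, h ∉ ι'.range := by
    by_contra! hall
    rw [(Subgroup.eq_top_iff' _).2 hall, Subgroup.index_top] at hι2'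
    omega
  obtain ⟨a, ha⟩ : h * h ∈ ι.range := Subgroup.mul_self_mem_of_index_two hι2 h
  obtain ⟨b, hb⟩ : h' * h' ∈ ι'.range := Subgroup.mul_self_mem_of_index_two hι2' h'
  have hra : r a = a := by
    apply hι
    rw [← hconj h hh, ha]
    group
  -- `b = h'²` commutes with `h'`, so `R A` fixes it.
  have hrb : φ ⟨j b, hj b⟩ = r (j b) := by
    obtain ⟨d, hd, hbd⟩ := hconj' h' hh' b
    have : d = b := by
      apply hι'
      rw [← hbd, hb]
      group
    rw [← hr (φ ⟨j b, hj b⟩), ← hd, this]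
  -- `h'²` lies in the abelian group `D` and acts trivially on it, so `(R A)² = 1` there.
  have hinv (d d' : D) (hd : j d' = r (φ ⟨j d, hj d⟩)) : (φ ⟨j d', hj d'⟩ : Λ) = r (j d) := by
    obtain ⟨d₁, hd₁, hc₁⟩ := hconj' h' hh' d
    obtain ⟨d₂, hd₂, hc₂⟩ := hconj' h' hh' d₁
    have e1 : d' = d₁ := hinj (hd.trans hd₁.symm)
    subst e1
    have e2 : d₂ = b * d * b⁻¹ := by
      apply hι'
      rw [← hc₂, ← hc₁, map_mul, map_mul, map_inv, hb]
      group
    have e3 : j d₂ = j d := by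
      rw [e2, map_mul, map_mul, map_inv, mul_comm (j b), mul_inv_cancel_right]
    rw [← e3, hd₂, hr]
  set inl := Amalgam.inl (ι.comp j) ι'
  set inr := Amalgam.inr (ι.comp j) ι'
  have glue (d : D) : inl (ι (j d)) = inr (ι' d) := Amalgam.inl_eq_inr d
  have hrel (c : C) : inl h * inr h' * inl (ι c) = inl (ι (φ c : Λ)) * (inl h * inr h') := by
    obtain ⟨d, hd⟩ := hsurj c
    obtain ⟨d', hd', hc⟩ := hconj' h' hh' d
    have e1 : (⟨j d, hj d⟩ : C) = c := Subtype.ext hd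
    rw [e1] at hd'
    have e2 := hconj h hh (j d')
    rw [mul_inv_eq_iff_eq_mul] at hc e2
    rw [hd', hr] at e2
    rw [← hd, glue, mul_assoc, ← map_mul, hc, map_mul, ← glue, hd', ← mul_assoc, ← map_mul, e2,
      map_mul, mul_assoc]
  let f : HNNExtension Λ C B φ →* Amalgam (ι.comp j) ι' :=
    HNNExtension.lift (inl.comp ι) (inl h * inr h') hrel
  have hfo (v : Λ) : f (HNNExtension.of v) = inl (ι v) := HNNExtension.lift_of _ _ _ v
  have hft : f HNNExtension.t = inl h * inr h' := HNNExtension.lift_t _ _ _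
  refine ⟨f, ?_, ?_, hfo⟩
  · let σ : HNNExtension Λ C B φ →* HNNExtension Λ C B φ :=
      HNNExtension.lift (HNNExtension.of.comp r) (HNNExtension.of (a * j b) * HNNExtension.t⁻¹) (by
        intro c
        obtain ⟨d, hd⟩ := hsurj c
        obtain ⟨d', hd', -⟩ := hconj' h' hh' d
        have e1 : (⟨j d, hj d⟩ : C) = c := Subtype.ext hd
        have e2 := hinv d d' hd'
        rw [e1] at hd'
        have e3 := HNNExtension.t_mul_of (φ := φ) ⟨j d', hj d'⟩
        change HNNExtension.t * HNNExtension.of (j d') = _ at e3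
        rw [e2, hd', hd] at e3
        have e4 : (HNNExtension.of (r (φ c)) : HNNExtension Λ C B φ) * HNNExtension.of (a * j b) =
            HNNExtension.of (a * j b) * HNNExtension.of (r (φ c)) := by
          rw [← map_mul, ← map_mul, mul_comm]
        rw [MonoidHom.comp_apply, MonoidHom.comp_apply, ← mul_assoc, e4, mul_assoc, mul_assoc]
        congr 1
        rw [inv_mul_eq_iff_eq_mul, ← mul_assoc, e3, mul_inv_cancel_right])
    have hσo (v : Λ) : σ (HNNExtension.of v) = HNNExtension.of (r v) := HNNExtension.lift_of _ _ _ v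
    have hσt : σ HNNExtension.t = HNNExtension.of (a * j b) * HNNExtension.t⁻¹ :=
      HNNExtension.lift_t _ _ _
    have hσσ (x : HNNExtension Λ C B φ) :
        σ (σ x) = HNNExtension.of a * x * (HNNExtension.of a)⁻¹ := by
      have : σ.comp σ = (MulAut.conj (HNNExtension.of a : HNNExtension Λ C B φ)).toMonoidHom := by
        refine HNNExtension.hom_ext (MonoidHom.ext fun v => ?_) ?_
        · change σ (σ (HNNExtension.of v)) = HNNExtension.of a * HNNExtension.of v *
            (HNNExtension.of a)⁻¹
          rw [hσo, hσo, hr, ← map_mul, ← map_inv, ← map_mul, mul_inv_cancel_comm]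
        · change σ (σ HNNExtension.t) = HNNExtension.of a * HNNExtension.t * (HNNExtension.of a)⁻¹
          have e3 := HNNExtension.t_mul_of (φ := φ) ⟨j b, hj b⟩
          rw [hrb] at e3
          change HNNExtension.t * HNNExtension.of (j b) = _ at e3
          rw [hσt, map_mul, map_inv, hσt, hσo, mul_inv_rev, inv_inv, map_mul, map_mul, hra,
            mul_assoc, ← mul_assoc (HNNExtension.of (r (j b))),
            ← e3, map_mul, mul_inv_rev]
          simp only [mul_assoc]
          rw [mul_inv_cancel_left]
      exact DFunLike.congr_fun this x
    obtain ⟨M, u, hM, huu, huM⟩ := exists_square_root σ (HNNExtension.of a)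
      (by rw [hσo, hra]) hσσ
    obtain ⟨p, hp, hpu⟩ := exists_lift_of_index_two hι hι2 hh (M.comp HNNExtension.of) u
      (by
        intro n hn
        rw [MonoidHom.comp_apply, huu, hι (hn.trans ha.symm)])
      (by
        intro n n' hn
        rw [MonoidHom.comp_apply, MonoidHom.comp_apply, huM, hσo]
        rw [hconj h hh] at hn
        rw [hι hn])
    have hut : M HNNExtension.t * u⁻¹ = u⁻¹ * M (HNNExtension.of (a * j b)) *
        (M HNNExtension.t)⁻¹ := by
      have := huM HNNExtension.t
      rw [hσt, map_mul, map_inv] at this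
      rw [mul_assoc, ← this]
      group
    -- The image of `h'` is forced by `h' = h⁻¹ (h h')`.
    obtain ⟨q, hq, hqu⟩ := exists_lift_of_index_two hι' hι2' hh'
      (M.comp (HNNExtension.of.comp j)) (u⁻¹ * M HNNExtension.t)
      (by
        intro n hn
        rw [hι' (hn.trans hb.symm)]
        change M (HNNExtension.of (j b)) = _
        rw [mul_assoc, ← mul_assoc (M _), hut, map_mul, map_mul, ← huu]
        group)
      (by
        intro n n' hn
        obtain ⟨d', hd', hc⟩ := hconj' h' hh' n
        have e1 : d' = n' := hι' (hc.symm.trans hn)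
        subst e1
        change u⁻¹ * M HNNExtension.t * M (HNNExtension.of (j n)) * (u⁻¹ * M HNNExtension.t)⁻¹
          = M (HNNExtension.of (j d'))
        have e3 := HNNExtension.t_mul_of (φ := φ) ⟨j n, hj n⟩
        change HNNExtension.t * HNNExtension.of (j n) = _ at e3
        have e4 := huM (HNNExtension.of (j d'))
        rw [hσo, hd', hr] at e4
        rw [mul_assoc u⁻¹, ← map_mul, e3, map_mul, hd', ← e4]
        group)
    obtain ⟨Ψ, hΨl, hΨr⟩ := Amalgam.exists_lift (f := ι.comp j) (f' := ι') p q (by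
      intro d
      rw [hq]
      exact hp (j d))
    have hΨ : Ψ.comp f = M := by
      refine HNNExtension.hom_ext (MonoidHom.ext fun v => ?_) ?_
      · change Ψ (f (HNNExtension.of v)) = M (HNNExtension.of v)
        rw [hfo, hΨl, hp]
        rfl
      · change Ψ (f HNNExtension.t) = _
        rw [hft, map_mul, hΨl, hΨr, hpu, hqu, mul_inv_cancel_left]
    refine Function.Injective.of_comp (f := Ψ) ?_
    rw [← MonoidHom.coe_comp, hΨ]
    exact hM
  · have hmemL (v : Λ) : inl (ι v) ∈ f.range := ⟨_, hfo v⟩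
    have hmemT : inl h * inr h' ∈ f.range := ⟨_, hft⟩
    have hsq : inl h * inl h ∈ f.range := by
      rw [← map_mul, ← ha]
      exact hmemL a
    have hnorm (x : Amalgam (ι.comp j) ι') (hx : x ∈ f.range) :
        inl h * x * (inl h)⁻¹ ∈ f.range := by
      obtain ⟨y, rfl⟩ := hx
      induction y using HNNExtension.induction_on with
      | of v =>
        rw [hfo, ← map_mul, ← map_inv, ← map_mul, hconj h hh]
        exact hmemL _
      | t =>
        have e : inl h * f HNNExtension.t * (inl h)⁻¹ =
            inl h * inl h * (inl h * inr h' * (inl (ι (j b)))⁻¹)⁻¹ := by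
          rw [hft, glue, hb, map_mul]
          group
        rw [e]
        exact mul_mem hsq (inv_mem (mul_mem hmemT (inv_mem (hmemL _))))
      | mul x y hx hy =>
        have e : inl h * f (x * y) * (inl h)⁻¹ =
            (inl h * f x * (inl h)⁻¹) * (inl h * f y * (inl h)⁻¹) := by
          rw [map_mul]
          group
        rw [e]
        exact mul_mem hx hy
      | inv x hx =>
        have e : inl h * f x⁻¹ * (inl h)⁻¹ = (inl h * f x * (inl h)⁻¹)⁻¹ := by
          rw [map_inv]
          group
        rw [e]
        exact inv_mem hx
    have hnorm' (x : Amalgam (ι.comp j) ι') (hx : x ∈ f.range) :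
        (inl h)⁻¹ * x * inl h ∈ f.range := by
      have e : (inl h)⁻¹ * x * inl h =
          (inl h * inl h)⁻¹ * (inl h * x * (inl h)⁻¹) * (inl h * inl h) := by group
      rw [e]
      exact mul_mem (mul_mem (inv_mem hsq) (hnorm x hx)) hsq
    -- The sign character, which shows that `h` is not in the image of `f`.
    obtain ⟨p, hp, hpu⟩ := exists_lift_of_index_two hι hι2 hh (1 : Λ →* ℤˣ) (-1)
      (fun _ _ => by simp) (fun _ _ _ => by simp)
    obtain ⟨q, hq, hqu⟩ := exists_lift_of_index_two hι' hι2' hh' (1 : D →* ℤˣ) (-1)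
      (fun _ _ => by simp) (fun _ _ _ => by simp)
    obtain ⟨χ, hχl, hχr⟩ := Amalgam.exists_lift (f := ι.comp j) (f' := ι') p q (by
      intro d
      rw [hq]
      exact hp (j d))
    have hχf : χ.comp f = 1 := by
      refine HNNExtension.hom_ext (MonoidHom.ext fun v => ?_) ?_
      · change χ (f (HNNExtension.of v)) = 1
        rw [hfo, hχl, hp]
        rfl
      · change χ (f HNNExtension.t) = 1
        rw [hft, map_mul, hχl, hχr, hpu, hqu]
        decide
    refine index_range_eq_two χ (DFunLike.congr_fun hχf) (by rw [hχl, hpu]) fun k => ?_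
    induction k using Amalgam.induction with
    | hl x =>
      rcases exists_eq_mul_of_index_two hι2 hh x with ⟨n, rfl⟩ | ⟨n, rfl⟩
      · exact Or.inl (hmemL n)
      · refine Or.inr ?_
        change inl (ι n * h) * inl h ∈ _
        rw [map_mul, mul_assoc]
        exact mul_mem (hmemL n) hsq
    | hr x =>
      rcases exists_eq_mul_of_index_two hι2' hh' x with ⟨n, rfl⟩ | ⟨n, rfl⟩
      · refine Or.inl ?_
        rw [← Amalgam.inl_eq_inr]
        exact hmemL (j n)
      · refine Or.inr ?_
        have e : inr (ι' n * h') * inl h = inl (ι (j n)) * inl (ι (j b)) *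
            (inl h * inr h')⁻¹ * (inl h * inl h) := by
          rw [glue, glue, hb, map_mul, map_mul]
          group
        change inr (ι' n * h') * inl h ∈ _
        rw [e]
        exact mul_mem (mul_mem (mul_mem (hmemL _) (hmemL _)) (inv_mem hmemT)) hsq
    | hmul x y hx hy =>
      rcases hx with hx | hx <;> rcases hy with hy | hy
      · exact Or.inl (mul_mem hx hy)
      · exact Or.inr (by rw [mul_assoc]; exact mul_mem hx hy)
      · refine Or.inr ?_
        have e : x * y * inl h = x * inl h * ((inl h)⁻¹ * y * inl h) := by group
        rw [e]
        exact mul_mem hx (hnorm' y hy)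
      · refine Or.inl ?_
        have e : x * y = x * inl h * ((inl h)⁻¹ * (y * inl h) * inl h) * (inl h * inl h)⁻¹ := by
          group
        rw [e]
        exact mul_mem (mul_mem hx (hnorm' _ hy)) (inv_mem hsq)

end Embedding

/-! ### Geometric actions of amalgams on the product of a tree and a Euclidean space -/

section Geometric

variable {ι K : Type} [Group K] {S : ι → Subgroup K} {C : Subgroup K}

namespace IsAmalgam

/-- The tree on which the amalgamated product acts, before points at distance zero are
identified. -/
abbrev Tree (hA : IsAmalgam S C) : Type := TreePoint hA.isTreeMetric

variable (hA : IsAmalgam S C)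

instance : MulAction K hA.Tree where
  smul g x := ⟨g * x.fst, g * x.snd, x.a, x.b, x.a_nonneg, x.b_nonneg, by
    rw [x.add_eq, mul_inv_rev, mul_assoc, inv_mul_cancel_left]⟩
  one_smul x := by
    change TreePoint.mk _ _ _ _ _ _ _ = x
    simp only [one_mul]
  mul_smul g h x := by
    change TreePoint.mk _ _ _ _ _ _ _ = TreePoint.mk _ _ _ _ _ _ _
    simp only [mul_assoc]
    rfl

theorem smul_fst (g : K) (x : hA.Tree) : (g • x).fst = g * x.fst := rfl

theorem smul_snd (g : K) (x : hA.Tree) : (g • x).snd = g * x.snd := rfl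

instance : IsIsometricSMul K hA.Tree where
  isometry_smul g := Isometry.of_dist_eq fun x y => by
    rw [TreePoint.dist_eq, TreePoint.dist_eq]
    have e (u v : K) : (g * u)⁻¹ * (g * v) = u⁻¹ * v := by group
    simp only [smul_fst, smul_snd, e]
    rfl

/-- The point on the edge from `1` to `x` at distance `s` from `1`. -/
noncomputable def edgePoint (x : K) (s : Set.Icc 0 (reducedLength S C x : ℝ)) : hA.Tree :=
  ⟨1, x, s, reducedLength S C x - s, s.2.1, sub_nonneg.2 s.2.2, by
    rw [inv_one, one_mul, add_sub_cancel]⟩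

theorem continuous_edgePoint (x : K) : Continuous (hA.edgePoint x) := by
  refine (LipschitzWith.of_dist_le_mul (K := 1) fun s t => ?_).continuous
  rw [NNReal.coe_one, one_mul, TreePoint.dist_eq, Subtype.dist_eq, Real.dist_eq]
  have hs := s.2
  have ht := t.2
  have h1 := le_abs_self (s - t : ℝ)
  have h2 := neg_abs_le (s - t : ℝ)
  have h3 := abs_nonneg (s - t : ℝ)
  have e := hA.length_of_mem C.one_mem
  simp only [edgePoint, inv_one, one_mul, mul_one, inv_mul_cancel, hA.length_inv, e, Nat.cast_zero]
  refine max_le (max_le ?_ ?_) (max_le ?_ ?_) <;> linarith [hs.1, hs.2, ht.1, ht.2]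

/-- An element `g` carries `x` to the edge from `1` to `y`. A further `c ∈ C` carries this edge to
the one from `c` to `c y`, which is at distance zero from the edge from `1` to `r`. The freedom in
`c` is kept for the Euclidean coordinate. -/
theorem exists_dist_edgePoint [Nonempty ι] (x : hA.Tree) :
    ∃ i, ∃ g : K, ∃ y ∈ S i, ∀ c ∈ C, ∀ r : K, r⁻¹ * (c * y) ∈ C →
      ∃ s, dist ((c * g) • x) (hA.edgePoint r s) = 0 := by
  have hx := x.add_eq
  have ha := x.a_nonneg
  have hb := x.b_nonneg
  obtain ⟨i, g, y, h, hy, hk, hlen, hs1, hs2⟩ :=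
    hA.exists_edge (x.fst⁻¹ * x.snd) (s := x.a) ⟨ha, by linarith⟩
  refine ⟨i, (x.fst * g)⁻¹, y, hy, fun c hc r hr => ?_⟩
  have hr' : reducedLength S C r = reducedLength S C y := by
    rw [← hA.length_mul_right hr r, mul_inv_cancel_left, hA.length_mul_left hc]
  refine ⟨⟨x.a - reducedLength S C g, by linarith, by rw [hr']; linarith⟩,
    le_antisymm ?_ dist_nonneg⟩
  rw [TreePoint.dist_eq, hA.smul_fst, hA.smul_snd]
  simp only [edgePoint]
  have e1 : (c * (x.fst * g)⁻¹ * x.fst)⁻¹ * 1 = g * c⁻¹ := by group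
  have e2 : (c * (x.fst * g)⁻¹ * x.fst)⁻¹ * r = g * y * (r⁻¹ * (c * y))⁻¹ := by group
  have e3 : c * (x.fst * g)⁻¹ * x.snd = c * (y * h) := by
    have : x.snd = x.fst * (g * y * h) := by rw [← hk]; group
    rw [this]
    group
  have e4 : (c * (y * h))⁻¹ * 1 = (c * (y * h))⁻¹ := mul_one _
  have e5 : (c * (y * h))⁻¹ * r = ((r⁻¹ * (c * y)) * h)⁻¹ := by group
  rw [e1, e2, e3, e4, e5, hA.length_inv, hA.length_inv, hA.length_mul_left hc,
    hA.length_mul_left hr, hA.length_mul_right (C.inv_mem hc), hA.length_mul_right (C.inv_mem hr),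
    hr']
  have l1 : (reducedLength S C (g * y) : ℝ) ≤ reducedLength S C g + reducedLength S C y := by
    exact_mod_cast hA.length_mul_le g y
  have l2 : (reducedLength S C (y * h) : ℝ) ≤ reducedLength S C y + reducedLength S C h := by
    exact_mod_cast hA.length_mul_le y h
  have l3 : x.a + x.b = reducedLength S C g + reducedLength S C y + reducedLength S C h := by
    rw [hx]
    exact_mod_cast hlen
  change max (max (_ - x.a - _) (_ - x.a - _)) (max (_ - x.b - _) (_ - x.b - _)) ≤ _
  refine max_le (max_le ?_ ?_) (max_le ?_ ?_) <;> linarith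

/-- Finite index of `C` in each `S i` leaves finitely many edges at `1` up to distance zero, and `C`
fixes that vertex; what remains is the action of `C` on `E`. -/
theorem isCAT0Group [Finite ι] [Nonempty ι] (hA : IsAmalgam S C)
    (hfin : ∀ i, ∃ F : Set K, F.Finite ∧ ∀ x ∈ S i, ∃ r ∈ F, r⁻¹ * x ∈ C)
    {E : Type} [NormedAddCommGroup E] [InnerProductSpace ℝ E] (ρ : K →* (E ≃ᵢ E))
    (hproper : ∀ (p q : E) (R : ℝ), {c : K | c ∈ C ∧ dist (ρ c p) q ≤ R}.Finite)
    (hcocompact : ∃ D : Set E, IsCompact D ∧ ∀ p, ∃ c ∈ C, ρ c p ∈ D) : IsCAT0Group K := by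
  let T := SeparationQuotient hA.Tree
  let X := WithLp 2 (T × E)
  let act : MulAction K X :=
    { smul := fun g x => WithLp.toLp 2 (g • x.fst, ρ g x.snd)
      one_smul := fun x => by
        change WithLp.toLp 2 ((1 : K) • x.fst, ρ 1 x.snd) = x
        rw [one_smul, map_one]
        rfl
      mul_smul := fun g h x => by
        change WithLp.toLp 2 ((g * h) • x.fst, ρ (g * h) x.snd) =
          WithLp.toLp 2 (g • h • x.fst, ρ g (ρ h x.snd))
        rw [mul_smul, map_mul]
        rfl }
  have hfst (g : K) (x : X) : (g • x).fst = g • x.fst := rfl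
  have hsnd (g : K) (x : X) : (g • x).snd = ρ g x.snd := rfl
  have hTdist (g : K) (x y : T) : dist (g • x) (g • y) = dist x y := by
    obtain ⟨x, rfl⟩ := SeparationQuotient.surjective_mk x
    obtain ⟨y, rfl⟩ := SeparationQuotient.surjective_mk y
    rw [← SeparationQuotient.mk_smul, ← SeparationQuotient.mk_smul, SeparationQuotient.dist_mk,
      SeparationQuotient.dist_mk, dist_smul]
  have hisom (g : K) (x y : X) : dist (g • x) (g • y) = dist x y := by
    refine (sq_eq_sq₀ dist_nonneg dist_nonneg).1 ?_
    rw [dist_sq_withLp, dist_sq_withLp, hfst, hfst, hsnd, hsnd, hTdist, (ρ g).dist_eq]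
  refine ⟨X, inferInstance, act, ?_, ?_, ⟨hisom, fun x => ⟨1, one_pos, ?_⟩, ?_⟩⟩
  · exact ⟨WithLp.toLp 2 (SeparationQuotient.mk (TreePoint.ofVertex 1), 0)⟩
  · exact (TreePoint.hasCN.separationQuotient.prod (hasCN_of_innerProductSpace E)).isCAT0Space
  · obtain ⟨t, ht⟩ := SeparationQuotient.surjective_mk x.fst
    -- If `g` moves `t` by at most `2`, it moves the vertex `t.fst`, at distance `t.a`, by at most
    -- `2 + 2 * t.a`.
    obtain ⟨N, hN⟩ := exists_nat_ge (2 + 2 * t.a)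
    obtain ⟨F, hF, hFN⟩ := hA.finite_cosets hfin N
    have hfinite : (⋃ r ∈ F, (fun c => t.fst * r * c * t.fst⁻¹) '' {c : K | c ∈ C ∧
        dist (ρ c (ρ t.fst⁻¹ x.snd)) (ρ (t.fst * r)⁻¹ x.snd) ≤ 2}).Finite :=
      hF.biUnion fun r _ => (hproper _ _ _).image _
    refine hfinite.subset ?_
    rintro g ⟨y, hy, hgy⟩
    have hgx : dist (g • x) x ≤ 2 := by
      have h1 := dist_triangle (g • x) (g • y) x
      rw [hisom, dist_comm x y] at h1
      rw [Metric.mem_ball] at hy hgy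
      linarith
    have hsq := dist_sq_withLp (g • x) x
    have h2 : dist (g • x) x ^ 2 ≤ 2 ^ 2 := pow_le_pow_left₀ dist_nonneg hgx 2
    have h3 : dist (g • x).fst x.fst ≤ 2 :=
      abs_le_of_sq_le_sq' (by nlinarith [sq_nonneg (dist (g • x).snd x.snd)]) zero_le_two |>.2
    have h4 : dist (g • x).snd x.snd ≤ 2 :=
      abs_le_of_sq_le_sq' (by nlinarith [sq_nonneg (dist (g • x).fst x.fst)]) zero_le_two |>.2
    rw [hfst, ← ht, ← SeparationQuotient.mk_smul, SeparationQuotient.dist_mk, dist_comm,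
      TreePoint.dist_eq] at h3
    have h5 := (le_max_left _ _).trans ((le_max_left _ _).trans h3)
    rw [hA.smul_fst] at h5
    change (reducedLength S C (t.fst⁻¹ * (g * t.fst)) : ℝ) - t.a - t.a ≤ 2 at h5
    have h6 : reducedLength S C (t.fst⁻¹ * (g * t.fst)) ≤ N := by
      have : (reducedLength S C (t.fst⁻¹ * (g * t.fst)) : ℝ) ≤ N := by linarith
      exact_mod_cast this
    obtain ⟨r, hr, hrC⟩ := hFN _ h6
    refine Set.mem_biUnion hr ⟨_, ⟨hrC, ?_⟩, by group⟩
    rw [hsnd] at h4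
    have e (u v : K) (p : E) : ρ u (ρ v p) = ρ (u * v) p := by rw [map_mul]; rfl
    have e1 : r⁻¹ * (t.fst⁻¹ * (g * t.fst)) * t.fst⁻¹ = (t.fst * r)⁻¹ * g := by group
    rw [e, e1, ← e, (ρ _).dist_eq]
    exact h4
  · choose F hF hFS using hfin
    obtain ⟨D, hD, hDC⟩ := hcocompact
    let Q : Set T := ⋃ i, ⋃ r ∈ F i, Set.range fun s => SeparationQuotient.mk (hA.edgePoint r s)
    have hQ : IsCompact Q := isCompact_iUnion fun i => (hF i).isCompact_biUnion fun r _ =>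
      isCompact_range (SeparationQuotient.continuous_mk.comp (hA.continuous_edgePoint r))
    refine ⟨WithLp.toLp 2 '' (Q ×ˢ D), (hQ.prod hD).image (WithLp.prod_continuous_toLp 2 T E),
      fun x => ?_⟩
    obtain ⟨t, ht⟩ := SeparationQuotient.surjective_mk x.fst
    obtain ⟨i, g, y, hy, H⟩ := hA.exists_dist_edgePoint t
    obtain ⟨c, hc, hcD⟩ := hDC (ρ g x.snd)
    obtain ⟨r, hr, hrC⟩ := hFS i (c * y) ((S i).mul_mem (hA.le i hc) hy)
    obtain ⟨s, hs⟩ := H c hc r hrC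
    have e : (c * g) • x.fst = SeparationQuotient.mk (hA.edgePoint r s) := by
      rw [← dist_eq_zero, ← ht, ← SeparationQuotient.mk_smul, SeparationQuotient.dist_mk, hs]
    refine ⟨(c * g)⁻¹, (c * g) • x, ⟨((c * g) • x.fst, ρ (c * g) x.snd), ⟨?_, ?_⟩, rfl⟩,
      inv_smul_smul _ _⟩
    · rw [e]
      exact Set.mem_iUnion.2 ⟨i, Set.mem_biUnion hr ⟨s, rfl⟩⟩
    · change ρ (c * g) x.snd ∈ D
      rw [map_mul]
      exact hcD

end IsAmalgam

end Geometric

/-! ### Invariant inner products and affine actions -/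

theorem norm_mulVec_of_mem_orthogonalGroup {m : Type*} [Fintype m] [DecidableEq m]
    {U : Matrix m m ℝ} (hU : U ∈ Matrix.orthogonalGroup m ℝ) (y : m → ℝ) :
    ‖WithLp.toLp 2 (U.mulVec y)‖ = ‖WithLp.toLp 2 y‖ := by
  refine (sq_eq_sq₀ (norm_nonneg _) (norm_nonneg _)).1 ?_
  have key (z : m → ℝ) : ‖WithLp.toLp 2 z‖ ^ 2 = z ⬝ᵥ z := by
    rw [EuclideanSpace.real_norm_sq_eq]
    simp only [dotProduct, sq]
  rw [key, key, Matrix.dotProduct_mulVec, ← Matrix.mulVec_transpose, Matrix.mulVec_mulVec,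
    (Matrix.mem_orthogonalGroup_iff' m ℝ).1 hU, Matrix.one_mulVec]

/-- The norm is `‖P y‖² + ‖P R y‖²`, realised on the image of `y ↦ (P y, P R y)`. `R` exchanges the
summands; so does `R A`, because `P R (R A) = P A` and `R A = A⁻¹ R` while `A` preserves `‖P y‖`. -/
theorem exists_invariant_norm {n : ℕ} {A R P : GL (Fin n) ℝ}
    (hP : ((P * A * P⁻¹ : GL (Fin n) ℝ) : Matrix (Fin n) (Fin n) ℝ)
      ∈ Matrix.orthogonalGroup (Fin n) ℝ)
    (hR : R * R = 1) (hRA : R * A * R = A⁻¹) :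
    ∃ (E : Type) (_ : NormedAddCommGroup E) (_ : InnerProductSpace ℝ E)
      (Φ : (Fin n → ℝ) ≃ₗ[ℝ] E),
      (∀ y, ‖Φ ((R : Matrix (Fin n) (Fin n) ℝ).mulVec y)‖ = ‖Φ y‖) ∧
      ∀ y, ‖Φ (((R * A : GL (Fin n) ℝ) : Matrix (Fin n) (Fin n) ℝ).mulVec y)‖ = ‖Φ y‖ := by
  let p (X : GL (Fin n) ℝ) (y : Fin n → ℝ) : EuclideanSpace ℝ (Fin n) :=
    WithLp.toLp 2 ((X : Matrix (Fin n) (Fin n) ℝ).mulVec y)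
  have hpmul (X Y : GL (Fin n) ℝ) (y : Fin n → ℝ) :
      p X ((Y : Matrix (Fin n) (Fin n) ℝ).mulVec y) = p (X * Y) y := by
    simp only [p, Matrix.mulVec_mulVec, Units.val_mul]
  have hpA (y : Fin n → ℝ) : ‖p (P * A) y‖ = ‖p P y‖ := by
    have := norm_mulVec_of_mem_orthogonalGroup hP ((P : Matrix (Fin n) (Fin n) ℝ).mulVec y)
    rwa [Matrix.mulVec_mulVec, ← Units.val_mul, inv_mul_cancel_right] at this
  let Ξ : (Fin n → ℝ) →ₗ[ℝ] WithLp 2 (EuclideanSpace ℝ (Fin n) × EuclideanSpace ℝ (Fin n)) :=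
    { toFun := fun y => WithLp.toLp 2 (p P y, p (P * R) y)
      map_add' := fun x y => by simp only [p, Matrix.mulVec_add]; rfl
      map_smul' := fun c y => by simp only [p, Matrix.mulVec_smul]; rfl }
  have hΞ (y : Fin n → ℝ) : ‖Ξ y‖ ^ 2 = ‖p P y‖ ^ 2 + ‖p (P * R) y‖ ^ 2 :=
    WithLp.prod_norm_sq_eq_of_L2 _
  have hinj : Function.Injective Ξ := by
    intro x y hxy
    have h1 : p P x = p P y := congrArg WithLp.fst hxy
    exact Matrix.mulVec_injective_of_isUnit P.isUnit (congrArg WithLp.ofLp h1)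
  refine ⟨LinearMap.range Ξ, inferInstance, inferInstance, LinearEquiv.ofInjective Ξ hinj,
    fun y => ?_, fun y => ?_⟩
  · change ‖Ξ _‖ = ‖Ξ _‖
    refine (sq_eq_sq₀ (norm_nonneg _) (norm_nonneg _)).1 ?_
    rw [hΞ, hΞ, hpmul, hpmul, mul_assoc, hR, mul_one, add_comm]
  · change ‖Ξ _‖ = ‖Ξ _‖
    refine (sq_eq_sq₀ (norm_nonneg _) (norm_nonneg _)).1 ?_
    have e1 : R * A = A⁻¹ * R := by rw [← hRA, mul_assoc (R * A), hR, mul_one]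
    have e2 : P * R * (R * A) = P * A := by rw [mul_assoc, ← mul_assoc R, hR, one_mul]
    have e3 : ‖p (P * (R * A)) y‖ = ‖p (P * R) y‖ := by
      rw [e1, ← hpmul, ← hpmul, ← hpA, hpmul, hpmul, mul_assoc, mul_inv_cancel_left, ← hpmul]
    rw [hΞ, hΞ, hpmul, hpmul, e2, e3, hpA, add_comm]

theorem exists_linearIsometryEquiv {W E : Type*} [AddCommGroup W] [Module ℝ W]
    [NormedAddCommGroup E] [InnerProductSpace ℝ E] (Φ : W ≃ₗ[ℝ] E) (X : W →ₗ[ℝ] W)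
    (hX : ∀ y, X (X y) = y) (hnorm : ∀ y, ‖Φ (X y)‖ = ‖Φ y‖) :
    ∃ U : E ≃ₗᵢ[ℝ] E, (∀ y, U (Φ y) = Φ (X y)) ∧ ∀ x, U (U x) = x := by
  let Y : E ≃ₗ[ℝ] E := (Φ.symm.trans (LinearEquiv.ofInvolutive X hX)).trans Φ
  have hY (x : E) : Y x = Φ (X (Φ.symm x)) := rfl
  refine ⟨⟨Y, fun x => ?_⟩, fun y => ?_, fun x => ?_⟩
  · rw [hY, hnorm, LinearEquiv.apply_symm_apply]
  · change Y (Φ y) = _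
    rw [hY, LinearEquiv.symm_apply_apply]
  · change Y (Y x) = x
    rw [hY, hY, LinearEquiv.symm_apply_apply, hX, LinearEquiv.apply_symm_apply]

theorem exists_affine_action {V H E : Type*} [AddCommGroup V] [Group H] [NormedAddCommGroup E]
    [InnerProductSpace ℝ E] {ι : Multiplicative V →* H} (hinj : Function.Injective ι)
    (hι : ι.range.index = 2) (β : V →+ E) (U : E ≃ₗᵢ[ℝ] E) (hU : ∀ x, U (U x) = x) (α : V → V)
    (hconj : ∀ h, h ∉ ι.range → ∀ v : V,
      h * ι (Multiplicative.ofAdd v) * h⁻¹ = ι (Multiplicative.ofAdd (α v)))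
    (hUβ : ∀ v, U (β v) = β (α v)) :
    ∃ Ψ : H →* (E ≃ᵢ E), ∀ (v : V) (x : E), Ψ (ι (Multiplicative.ofAdd v)) x = x + β v := by
  obtain ⟨h, hh⟩ : ∃ h, h ∉ ι.range := by
    by_contra! hall
    rw [(Subgroup.eq_top_iff' _).2 hall, Subgroup.index_top] at hι
    omega
  obtain ⟨a, ha⟩ : h * h ∈ ι.range := Subgroup.mul_self_mem_of_index_two hι h
  have hαa : α a.toAdd = a.toAdd := by
    have : ι (Multiplicative.ofAdd (α a.toAdd)) = ι a := by
      rw [← hconj h hh a.toAdd, ofAdd_toAdd, ha]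
      group
    exact hinj this
  let τ : Multiplicative V →* (E ≃ᵢ E) :=
    { toFun := fun v => IsometryEquiv.addRight (β v.toAdd)
      map_one' := IsometryEquiv.ext fun x => by simp
      map_mul' := fun v w => IsometryEquiv.ext fun x => by
        change x + β (v.toAdd + w.toAdd) = x + β w.toAdd + β v.toAdd
        rw [map_add]
        abel }
  have hτ (v : Multiplicative V) (x : E) : τ v x = x + β v.toAdd := rfl
  -- `h` acts as `x ↦ U x + w`. As `a = h²` is fixed by `h`, also `U w = w`, so the square is
  -- translation by `2 w = β a`.
  let w : E := (2⁻¹ : ℝ) • β a.toAdd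
  have hw : U w = w := by
    simp only [w]
    rw [map_smul, hUβ, hαa]
  have hww : w + w = β a.toAdd := by
    simp only [w]
    rw [← two_smul ℝ, smul_smul, mul_inv_cancel₀ two_ne_zero, one_smul]
  let m : E ≃ᵢ E := U.toIsometryEquiv.trans (IsometryEquiv.addRight w)
  have hm (x : E) : m x = U x + w := rfl
  obtain ⟨Ψ, hΨ, -⟩ := exists_lift_of_index_two hinj hι hh τ m
    (by
      intro v hv
      rw [hinj (hv.trans ha.symm)]
      refine IsometryEquiv.ext fun x => ?_
      rw [IsometryEquiv.mul_apply, hm, hm, map_add, hU, hw, hτ, ← hww, add_assoc])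
    (by
      intro v v' hv
      have e := hconj h hh v.toAdd
      rw [ofAdd_toAdd, hv] at e
      rw [mul_inv_eq_iff_eq_mul, hinj e]
      refine IsometryEquiv.ext fun x => ?_
      rw [IsometryEquiv.mul_apply, IsometryEquiv.mul_apply, hm, hm, hτ, hτ, map_add, hUβ,
        toAdd_ofAdd]
      abel)
  exact ⟨Ψ, fun v x => by rw [hΨ]; rfl⟩

theorem exists_finite_cosets_of_index_two {N H K : Type*} [Group N] [Group H] [Group K]
    {ι : N →* H} (hι : ι.range.index = 2) (k : H →* K) (C : Subgroup K) {F : Set N}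
    (hF : F.Finite) (hFC : ∀ n, ∃ r ∈ F, k (ι (r⁻¹ * n)) ∈ C) :
    ∃ F' : Set K, F'.Finite ∧ ∀ x ∈ k.range, ∃ r ∈ F', r⁻¹ * x ∈ C := by
  obtain ⟨h, hh⟩ : ∃ h, h ∉ ι.range := by
    by_contra! hall
    rw [(Subgroup.eq_top_iff' _).2 hall, Subgroup.index_top] at hι
    omega
  refine ⟨(fun n => k (ι n)) '' F ∪ (fun n => k (h⁻¹ * ι n)) '' F,
    (hF.image _).union (hF.image _), ?_⟩
  rintro _ ⟨x, rfl⟩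
  -- Decomposing `x⁻¹` puts `h⁻¹` on the left of `x`, as left cosets of `C` require.
  rcases exists_eq_mul_of_index_two hι hh x⁻¹ with ⟨n, hn⟩ | ⟨n, hn⟩
  · obtain ⟨r, hr, hrC⟩ := hFC n⁻¹
    refine ⟨_, Or.inl ⟨r, hr, rfl⟩, ?_⟩
    rwa [inv_eq_iff_eq_inv.1 hn, ← map_inv, ← map_inv, ← map_inv, ← map_mul, ← map_mul]
  · obtain ⟨r, hr, hrC⟩ := hFC n⁻¹
    refine ⟨_, Or.inr ⟨r, hr, rfl⟩, ?_⟩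
    have e : (k (h⁻¹ * ι r))⁻¹ * k x = k (ι (r⁻¹ * n⁻¹)) := by
      rw [← map_inv k, ← map_mul k, inv_eq_iff_eq_inv.1 hn, map_mul ι, map_inv ι, map_inv ι]
      group
    change (k (h⁻¹ * ι r))⁻¹ * k x ∈ C
    rwa [e]

/-! ### Lattices -/

section Lattice

variable {n : ℕ}

/-- Multiplication by the integer matrix `R`. -/
def mulVecInt (R : GL (Fin n) ℤ) : (Fin n → ℤ) →+ (Fin n → ℤ) :=
  (Matrix.mulVecLin (R : Matrix (Fin n) (Fin n) ℤ)).toAddMonoidHom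

theorem mulVecInt_mulVecInt {R : GL (Fin n) ℤ} (hR : R ^ 2 = 1) (v : Fin n → ℤ) :
    mulVecInt R (mulVecInt R v) = v := by
  change (R : Matrix (Fin n) (Fin n) ℤ).mulVec ((R : Matrix (Fin n) (Fin n) ℤ).mulVec v) = v
  rw [Matrix.mulVec_mulVec, ← Units.val_mul, ← sq, hR, Units.val_one, Matrix.one_mulVec]

theorem castVec_mulVecInt (R : GL (Fin n) ℤ) (v : Fin n → ℤ) :
    castVec n (mulVecInt R v) = (toRat R : Matrix (Fin n) (Fin n) ℚ).mulVec (castVec n v) :=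
  funext fun i => RingHom.map_mulVec (Int.castRingHom ℚ) (R : Matrix (Fin n) (Fin n) ℤ) v i

/-- The inclusion `ℤⁿ → ℝⁿ`. -/
def realVec (n : ℕ) : (Fin n → ℤ) →+ (Fin n → ℝ) :=
  (Int.castAddHom ℝ).compLeft (Fin n)

theorem realVec_eq_mulVec {A : GL (Fin n) ℚ} {v w : Fin n → ℤ}
    (h : castVec n w = (A : Matrix (Fin n) (Fin n) ℚ).mulVec (castVec n v)) :
    realVec n w = (toReal A : Matrix (Fin n) (Fin n) ℝ).mulVec (realVec n v) := by
  have e (u : Fin n → ℤ) : realVec n u = algebraMap ℚ ℝ ∘ castVec n u :=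
    funext fun i => (Rat.cast_intCast (u i)).symm
  rw [e, e, h]
  exact funext fun i => RingHom.map_mulVec (algebraMap ℚ ℝ) (A : Matrix (Fin n) (Fin n) ℚ) _ i

theorem exists_nsmul_mem_interLattice (A : GL (Fin n) ℚ) :
    ∃ N : ℕ, 0 < N ∧ ∀ v : Fin n → ℤ, N • v ∈ interLattice A := by
  -- A common denominator of the entries of `A`.
  let N : ℕ := ∏ i, ∏ j, ((A : Matrix (Fin n) (Fin n) ℚ) i j).den
  have hN : ∀ i j, ∃ z : ℤ, (A : Matrix (Fin n) (Fin n) ℚ) i j * N = z := by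
    intro i j
    obtain ⟨k, hk⟩ : ((A : Matrix (Fin n) (Fin n) ℚ) i j).den ∣ N :=
      (Finset.dvd_prod_of_mem (fun j => ((A : Matrix (Fin n) (Fin n) ℚ) i j).den)
        (Finset.mem_univ j)).trans (Finset.dvd_prod_of_mem
          (fun i => ∏ j, ((A : Matrix (Fin n) (Fin n) ℚ) i j).den) (Finset.mem_univ i))
    refine ⟨((A : Matrix (Fin n) (Fin n) ℚ) i j).num * k, ?_⟩
    rw [hk]
    push_cast
    rw [← mul_assoc, Rat.mul_den_eq_num]
  choose Z hZ using hN
  refine ⟨N, Finset.prod_pos fun i _ => Finset.prod_pos fun j _ => Rat.den_pos _, fun v => ?_⟩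
  refine ⟨fun i => ∑ j, Z i j * v j, funext fun i => ?_⟩
  change ((∑ j, Z i j * v j : ℤ) : ℚ) = ∑ j, (A : Matrix (Fin n) (Fin n) ℚ) i j * ((N • v j : ℤ) : ℚ)
  push_cast
  refine Finset.sum_congr rfl fun j _ => ?_
  rw [← hZ, nsmul_eq_mul, mul_assoc]
  push_cast
  rfl

/-- All finiteness and cocompactness of `L'` comes from the sublattice `N ℤⁿ`. -/
theorem exists_nsmul_mem (A : GL (Fin n) ℚ) {L' : AddSubgroup (Fin n → ℤ)}
    (hfin : L'.relIndex (interLattice A) ≠ 0) :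
    ∃ N : ℕ, 0 < N ∧ ∀ v : Fin n → ℤ, N • v ∈ L' := by
  obtain ⟨N, hN, hNA⟩ := exists_nsmul_mem_interLattice A
  refine ⟨L'.relIndex (interLattice A) * N, Nat.mul_pos (Nat.pos_of_ne_zero hfin) hN, fun v => ?_⟩
  rw [mul_smul]
  exact (L'.addSubgroupOf (interLattice A)).nsmul_index_mem ⟨N • v, hNA v⟩

theorem exists_finite_reps {L' : AddSubgroup (Fin n → ℤ)} {N : ℕ} (hN : 0 < N)
    (hNL : ∀ v : Fin n → ℤ, N • v ∈ L') :
    ∃ F : Set (Fin n → ℤ), F.Finite ∧ ∀ v, ∃ r ∈ F, v - r ∈ L' := by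
  have hN' : (0 : ℤ) < N := by exact_mod_cast hN
  refine ⟨Set.Icc 0 fun _ => (N : ℤ), Set.finite_Icc _ _, fun v => ?_⟩
  refine ⟨fun i => v i % N, ⟨fun i => Int.emod_nonneg _ hN'.ne',
    fun i => (Int.emod_lt_of_pos _ hN').le⟩, ?_⟩
  have e : (v - fun i => v i % N) = N • fun i => v i / N := by
    funext i
    have := Int.emod_add_mul_ediv (v i) N
    simp only [Pi.sub_apply, Pi.smul_apply, nsmul_eq_mul]
    linarith
  rw [e]
  exact hNL _

variable {E : Type*} [NormedAddCommGroup E] [InnerProductSpace ℝ E]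

theorem finite_norm_realVec_le (Φ : (Fin n → ℝ) ≃ₗ[ℝ] E) (r : ℝ) :
    {v : Fin n → ℤ | ‖Φ (realVec n v)‖ ≤ r}.Finite := by
  have : FiniteDimensional ℝ E := Φ.finiteDimensional
  let Φ' := Φ.symm.toContinuousLinearEquiv
  obtain ⟨N, hN⟩ := exists_nat_ge (‖(Φ' : E →L[ℝ] (Fin n → ℝ))‖ * r)
  refine (Set.finite_Icc (fun _ => -(N : ℤ)) (fun _ => (N : ℤ))).subset fun v hv => ?_
  have hb (i : Fin n) : |v i| ≤ (N : ℤ) := by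
    have h1 : ‖realVec n v i‖ ≤ ‖realVec n v‖ := norm_le_pi_norm _ i
    have h2 := (Φ' : E →L[ℝ] (Fin n → ℝ)).le_opNorm (Φ (realVec n v))
    have h3 : (Φ' : E →L[ℝ] (Fin n → ℝ)) (Φ (realVec n v)) = realVec n v :=
      Φ.symm_apply_apply _
    rw [h3] at h2
    have h4 := h2.trans (mul_le_mul_of_nonneg_left hv (norm_nonneg _))
    have h5 : |(v i : ℝ)| ≤ N := (h1.trans h4).trans hN
    exact_mod_cast h5
  exact ⟨fun i => (abs_le.1 (hb i)).1, fun i => (abs_le.1 (hb i)).2⟩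

theorem exists_isCompact_add_mem (Φ : (Fin n → ℝ) ≃ₗ[ℝ] E) {L' : AddSubgroup (Fin n → ℤ)} {N : ℕ}
    (hN : 0 < N) (hNL : ∀ v : Fin n → ℤ, N • v ∈ L') :
    ∃ D : Set E, IsCompact D ∧ ∀ p, ∃ v ∈ L', p + Φ (realVec n v) ∈ D := by
  have hN' : (0 : ℝ) < N := by exact_mod_cast hN
  have : FiniteDimensional ℝ E := Φ.finiteDimensional
  let Φ' := Φ.toContinuousLinearEquiv
  refine ⟨Φ' '' Set.Icc 0 fun _ => (N : ℝ), isCompact_Icc.image Φ'.continuous, fun p => ?_⟩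
  obtain ⟨y, rfl⟩ := Φ.surjective p
  refine ⟨N • fun i => -⌊y i / N⌋, hNL _, ?_⟩
  rw [← map_add]
  refine ⟨_, ⟨fun i => ?_, fun i => ?_⟩, rfl⟩
  · have := Int.sub_floor_div_mul_nonneg (y i) hN'
    change 0 ≤ y i + ((N • (-⌊y i / N⌋) : ℤ) : ℝ)
    rw [nsmul_eq_mul]
    push_cast
    linarith
  · have := Int.sub_floor_div_mul_lt (y i) hN'
    change y i + ((N • (-⌊y i / N⌋) : ℤ) : ℝ) ≤ N
    rw [nsmul_eq_mul]
    push_cast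
    linarith

end Lattice

/-! ### The groups `H`, `H'` and `K` of the theorem -/

section Main

variable {n : ℕ} {A : GL (Fin n) ℚ} {L' : AddSubgroup (Fin n → ℤ)} {R : GL (Fin n) ℤ}

/-- `R A L' = R (R L') = L'`. -/
theorem mulVecInt_latticeEquiv_mem (hL' : L' ≤ interLattice A) (hR : R ^ 2 = 1)
    (hRL : L'.map (mulVecInt R) = imageLattice A L') (d : L') :
    mulVecInt R (latticeEquiv A L' hL' d) ∈ L' := by
  obtain ⟨u, hu, hud⟩ := hRL.ge (latticeEquiv A L' hL' d).2
  rw [← hud, mulVecInt_mulVecInt hR]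
  exact hu

/-- Multiplication by `R A` on `L'`. -/
noncomputable def mulVecSub (hL' : L' ≤ interLattice A) (hR : R ^ 2 = 1)
    (hRL : L'.map (mulVecInt R) = imageLattice A L') : L' →+ L' :=
  ((mulVecInt R).comp ((imageLattice A L').subtype.comp
    (latticeEquiv A L' hL').toAddMonoidHom)).codRestrict L' (mulVecInt_latticeEquiv_mem hL' hR hRL)

theorem coe_mulVecSub (hL' : L' ≤ interLattice A) (hR : R ^ 2 = 1)
    (hRL : L'.map (mulVecInt R) = imageLattice A L') (d : L') :
    (mulVecSub hL' hR hRL d : Fin n → ℤ) = mulVecInt R (latticeEquiv A L' hL' d) := rfl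

theorem castVec_mulVecSub (hL' : L' ≤ interLattice A) (hR : R ^ 2 = 1)
    (hRL : L'.map (mulVecInt R) = imageLattice A L') (d : L') :
    castVec n (mulVecSub hL' hR hRL d) =
      (toRat R * A : Matrix (Fin n) (Fin n) ℚ).mulVec (castVec n d) := by
  rw [coe_mulVecSub, castVec_mulVecInt, castVec_latticeEquiv, Matrix.mulVec_mulVec]

theorem toRat_mul_self (hR : R ^ 2 = 1) : toRat R * toRat R = 1 := by
  rw [toRat, ← map_mul, ← sq, hR, map_one]

theorem toRat_mul_sq (hRA : toRat R * A * toRat R = A⁻¹) :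
    toRat R * A * (toRat R * A) = 1 := by
  rw [← mul_assoc, hRA, inv_mul_cancel]

theorem mulVecSub_mulVecSub (hL' : L' ≤ interLattice A) (hR : R ^ 2 = 1)
    (hRL : L'.map (mulVecInt R) = imageLattice A L') (hRA : toRat R * A * toRat R = A⁻¹) (d : L') :
    mulVecSub hL' hR hRL (mulVecSub hL' hR hRL d) = d := by
  refine Subtype.ext (castVec_injective n ?_)
  rw [castVec_mulVecSub, castVec_mulVecSub, Matrix.mulVec_mulVec, ← Units.val_mul, ← Units.val_mul,
    toRat_mul_sq hRA, Units.val_one, Matrix.one_mulVec]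

theorem exists_overgroups (hL' : L' ≤ interLattice A) (hR : R ^ 2 = 1)
    (hRL : L'.map (mulVecInt R) = imageLattice A L') (hRA : toRat R * A * toRat R = A⁻¹) :
    ∃ (H H' : Type) (_ : Group H) (_ : Group H')
      (ι : Multiplicative (Fin n → ℤ) →* H) (ι' : Multiplicative L' →* H'),
      IsIndexTwoOvergroup (castVec n) (toRat R : Matrix (Fin n) (Fin n) ℚ) ι ∧
      IsIndexTwoOvergroup ((castVec n).comp L'.subtype)
        (toRat R * A : Matrix (Fin n) (Fin n) ℚ) ι' := by
  obtain ⟨H, i, ι, hι, hι2, hconj⟩ :=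
    exists_indexTwoOvergroup (mulVecInt R) (mulVecInt_mulVecInt hR)
  obtain ⟨H', i', ι', hι', hι2', hconj'⟩ :=
    exists_indexTwoOvergroup (mulVecSub hL' hR hRL) (mulVecSub_mulVecSub hL' hR hRL hRA)
  exact ⟨H, H', i, i', ι, ι',
    ⟨hι, hι2, fun h hh v => ⟨_, castVec_mulVecInt R v, hconj h hh v⟩⟩,
    ⟨hι', hι2', fun h hh d => ⟨_, castVec_mulVecSub hL' hR hRL d, hconj' h hh d⟩⟩⟩

variable {H H' : Type} [Group H] [Group H'] {ι : Multiplicative (Fin n → ℤ) →* H}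
  {ι' : Multiplicative L' →* H'}

theorem IsIndexTwoOvergroup.conj_eq
    (hι : IsIndexTwoOvergroup (castVec n) (toRat R : Matrix (Fin n) (Fin n) ℚ) ι) (h : H)
    (hh : h ∉ ι.range) (v : Fin n → ℤ) :
    h * ι (Multiplicative.ofAdd v) * h⁻¹ = ι (Multiplicative.ofAdd (mulVecInt R v)) := by
  obtain ⟨w, hw, e⟩ := hι.conj h hh v
  rw [e, castVec_injective n (hw.trans (castVec_mulVecInt R v).symm)]

theorem IsIndexTwoOvergroup.conj_eq_sub (hL' : L' ≤ interLattice A) (hR : R ^ 2 = 1)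
    (hRL : L'.map (mulVecInt R) = imageLattice A L')
    (hι' : IsIndexTwoOvergroup ((castVec n).comp L'.subtype)
        (toRat R * A : Matrix (Fin n) (Fin n) ℚ) ι') (h : H')
    (hh : h ∉ ι'.range) (d : L') :
    h * ι' (Multiplicative.ofAdd d) * h⁻¹ =
      ι' (Multiplicative.ofAdd (mulVecSub hL' hR hRL d)) := by
  obtain ⟨w, hw, e⟩ := hι'.conj h hh d
  have : w = mulVecSub hL' hR hRL d :=
    Subtype.ext (castVec_injective n (hw.trans (castVec_mulVecSub hL' hR hRL d).symm))
  rw [e, this]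

theorem exists_embedding_G (hL' : L' ≤ interLattice A) (hR : R ^ 2 = 1)
    (hRL : L'.map (mulVecInt R) = imageLattice A L')
    (hι : IsIndexTwoOvergroup (castVec n) (toRat R : Matrix (Fin n) (Fin n) ℚ) ι)
    (hι' : IsIndexTwoOvergroup ((castVec n).comp L'.subtype)
        (toRat R * A : Matrix (Fin n) (Fin n) ℚ) ι') :
    ∃ f : G A L' hL' →* K ι ι', Function.Injective f ∧ f.range.index = 2 ∧
      ∀ v : Multiplicative (Fin n → ℤ), f (HNNExtension.of v) = Amalgam.inl _ _ (ι v) :=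
  exists_embedding (stableEquiv A L' hL') (AddMonoidHom.toMultiplicative L'.subtype)
    (fun d => d.toAdd.2) (fun _ _ h => Subtype.ext h)
    (fun c => ⟨Multiplicative.ofAdd ⟨c.1.toAdd, c.2⟩, rfl⟩) ι ι' hι.injective hι'.injective
    hι.index_eq hι'.index_eq (AddMonoidHom.toMultiplicative (mulVecInt R))
    (fun v => mulVecInt_mulVecInt hR v.toAdd) (fun h hh v => hι.conj_eq h hh v.toAdd)
    (fun h hh d => ⟨Multiplicative.ofAdd (mulVecSub hL' hR hRL d.toAdd), rfl,
      hι'.conj_eq_sub hL' hR hRL h hh d.toAdd⟩)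

theorem isCAT0Group_K (hL' : L' ≤ interLattice A) (hfin : L'.relIndex (interLattice A) ≠ 0)
    (hR : R ^ 2 = 1) (hRL : L'.map (mulVecInt R) = imageLattice A L')
    (hRA : toRat R * A * toRat R = A⁻¹)
    (hι : IsIndexTwoOvergroup (castVec n) (toRat R : Matrix (Fin n) (Fin n) ℚ) ι)
    (hι' : IsIndexTwoOvergroup ((castVec n).comp L'.subtype)
        (toRat R * A : Matrix (Fin n) (Fin n) ℚ) ι') {P : GL (Fin n) ℝ}
    (hP : ((P * toReal A * P⁻¹ : GL (Fin n) ℝ) : Matrix (Fin n) (Fin n) ℝ)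
      ∈ Matrix.orthogonalGroup (Fin n) ℝ) : IsCAT0Group (K ι ι') := by
  have toReal_mul (X Y : GL (Fin n) ℚ) : toReal (X * Y) = toReal X * toReal Y :=
    map_mul (Matrix.GeneralLinearGroup.map (algebraMap ℚ ℝ)) X Y
  have toReal_one : toReal (1 : GL (Fin n) ℚ) = 1 :=
    map_one (Matrix.GeneralLinearGroup.map (algebraMap ℚ ℝ))
  have toReal_inv (X : GL (Fin n) ℚ) : toReal X⁻¹ = (toReal X)⁻¹ :=
    map_inv (Matrix.GeneralLinearGroup.map (algebraMap ℚ ℝ)) X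
  obtain ⟨E, _, _, Φ, hΦ, hΦ'⟩ := exists_invariant_norm (R := toReal (toRat R)) hP
    (by rw [← toReal_mul, toRat_mul_self hR, toReal_one])
    (by rw [← toReal_mul, ← toReal_mul, hRA, toReal_inv])
  rw [← toReal_mul] at hΦ'
  have hinvol (X : GL (Fin n) ℚ) (hX : X * X = 1) (y : Fin n → ℝ) :
      Matrix.mulVecLin (toReal X : Matrix (Fin n) (Fin n) ℝ)
        (Matrix.mulVecLin (toReal X : Matrix (Fin n) (Fin n) ℝ) y) = y := by
    rw [Matrix.mulVecLin_apply, Matrix.mulVecLin_apply, Matrix.mulVec_mulVec, ← Units.val_mul,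
      ← toReal_mul, hX, toReal_one, Units.val_one, Matrix.one_mulVec]
  obtain ⟨U, hU, hUU⟩ := exists_linearIsometryEquiv Φ
    (Matrix.mulVecLin (toReal (toRat R) : Matrix (Fin n) (Fin n) ℝ))
    (hinvol _ (toRat_mul_self hR)) hΦ
  obtain ⟨U', hU', hUU'⟩ := exists_linearIsometryEquiv Φ
    (Matrix.mulVecLin (toReal (toRat R * A) : Matrix (Fin n) (Fin n) ℝ))
    (hinvol _ (toRat_mul_sq hRA)) hΦ'
  let β : (Fin n → ℤ) →+ E := Φ.toLinearMap.toAddMonoidHom.comp (realVec n)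
  have hβ (v : Fin n → ℤ) : β v = Φ (realVec n v) := rfl
  obtain ⟨p, hp⟩ := exists_affine_action hι.injective hι.index_eq β U hUU (mulVecInt R)
    hι.conj_eq (fun v => by
      rw [hβ, hβ, hU, realVec_eq_mulVec (castVec_mulVecInt R v)]
      rfl)
  obtain ⟨q, hq⟩ := exists_affine_action hι'.injective hι'.index_eq (β.comp L'.subtype) U' hUU'
    (mulVecSub hL' hR hRL) (hι'.conj_eq_sub hL' hR hRL) (fun d => by
      change U' (Φ (realVec n d)) = Φ (realVec n (mulVecSub hL' hR hRL d))
      rw [hU', realVec_eq_mulVec (A := toRat R * A) (castVec_mulVecSub hL' hR hRL d)]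
      rfl)
  let j : Multiplicative L' →* Multiplicative (Fin n → ℤ) :=
    AddMonoidHom.toMultiplicative L'.subtype
  have hj : Function.Injective j := fun _ _ h => Subtype.ext h
  -- Both affine actions are by the same translations on `L'`, so they glue.
  obtain ⟨ρ, hρl, hρr⟩ := Amalgam.exists_lift (f := ι.comp j) (f' := ι') p q
    (fun d => IsometryEquiv.ext fun x => (hp d.toAdd.1 x).trans (hq d.toAdd x).symm)
  have hφ : ∀ b, Function.Injective (famHom (ι.comp j) ι' b) := fun b => match b with
    | false => hι.injective.comp hj
    | true => hι'.injective
  have hA := isAmalgam_pushoutI hφ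
  have hbase (c : Multiplicative L') : Monoid.PushoutI.base (famHom (ι.comp j) ι') c =
      Amalgam.inl (ι.comp j) ι' (ι (j c)) :=
    (Monoid.PushoutI.of_apply_eq_base (famHom (ι.comp j) ι') false c).symm
  have hbase' (c : Multiplicative L') : Monoid.PushoutI.base (famHom (ι.comp j) ι') c =
      Amalgam.inr (ι.comp j) ι' (ι' c) :=
    (Monoid.PushoutI.of_apply_eq_base (famHom (ι.comp j) ι') true c).symm
  have hρ (c : Multiplicative L') (x : E) :
      ρ (Monoid.PushoutI.base (famHom (ι.comp j) ι') c) x = x + Φ (realVec n c.toAdd) := by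
    rw [hbase, hρl]
    exact hp _ _
  obtain ⟨N, hN, hNL⟩ := exists_nsmul_mem A hfin
  refine hA.isCAT0Group ?_ ρ ?_ ?_
  · intro b
    cases b with
    | false =>
      obtain ⟨F, hF, hFL⟩ := exists_finite_reps hN hNL
      refine exists_finite_cosets_of_index_two hι.index_eq (Amalgam.inl (ι.comp j) ι') _
        (F := Multiplicative.toAdd ⁻¹' F) hF fun v => ?_
      obtain ⟨r, hr, hrv⟩ := hFL v.toAdd
      refine ⟨Multiplicative.ofAdd r, hr, Multiplicative.ofAdd ⟨_, hrv⟩, ?_⟩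
      rw [hbase]
      congr 2
      exact sub_eq_neg_add v.toAdd r
    | true =>
      -- Here the index-two subgroup is the amalgamated subgroup itself, so one representative
      -- suffices.
      refine exists_finite_cosets_of_index_two hι'.index_eq (Amalgam.inr (ι.comp j) ι') _
        (Set.finite_singleton 1) fun d => ⟨1, rfl, d, ?_⟩
      rw [hbase', inv_one, one_mul]
  · intro x y r
    have h1 := (finite_norm_realVec_le (n := n) Φ (r + dist x y)).preimage
      (Subtype.val_injective (p := (· ∈ L'))).injOn
    refine (h1.image fun d => Monoid.PushoutI.base (famHom (ι.comp j) ι')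
      (Multiplicative.ofAdd d)).subset ?_
    rintro _ ⟨⟨c, rfl⟩, hc⟩
    rw [hρ] at hc
    refine ⟨c.toAdd, ?_, rfl⟩
    change ‖Φ (realVec n c.toAdd)‖ ≤ _
    have h2 := dist_triangle_right (x + Φ (realVec n c.toAdd)) x y
    rw [dist_eq_norm, add_sub_cancel_left] at h2
    linarith
  · obtain ⟨D, hD, hDL⟩ := exists_isCompact_add_mem Φ hN hNL
    refine ⟨D, hD, fun x => ?_⟩
    obtain ⟨v, hv, hvD⟩ := hDL x
    refine ⟨_, ⟨Multiplicative.ofAdd ⟨v, hv⟩, rfl⟩, ?_⟩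
    rw [hρ]
    exact hvD

end Main

end CommHNN

theorem mainTheorem9 (n : ℕ) (A : GL (Fin n) ℚ) (L' : AddSubgroup (Fin n → ℤ))
    (hL' : L' ≤ CommHNN.interLattice A) (hfin : L'.relIndex (CommHNN.interLattice A) ≠ 0)
    (R : GL (Fin n) ℤ) (hR : R ^ 2 = 1)
    (hRA : CommHNN.toRat R * A * CommHNN.toRat R = A⁻¹)
    (hRL : L'.map (Matrix.mulVecLin (R : Matrix (Fin n) (Fin n) ℤ)).toAddMonoidHom
      = CommHNN.imageLattice A L') :
    (∃ (H H' : Type) (_ : Group H) (_ : Group H')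
      (ι : Multiplicative (Fin n → ℤ) →* H) (ι' : Multiplicative L' →* H'),
      CommHNN.IsIndexTwoOvergroup (CommHNN.castVec n)
        (CommHNN.toRat R : Matrix (Fin n) (Fin n) ℚ) ι ∧
      CommHNN.IsIndexTwoOvergroup ((CommHNN.castVec n).comp L'.subtype)
        (CommHNN.toRat R * A : Matrix (Fin n) (Fin n) ℚ) ι') ∧
    ∀ (H H' : Type) [Group H] [Group H']
      (ι : Multiplicative (Fin n → ℤ) →* H) (ι' : Multiplicative L' →* H'),
      CommHNN.IsIndexTwoOvergroup (CommHNN.castVec n)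
        (CommHNN.toRat R : Matrix (Fin n) (Fin n) ℚ) ι →
      CommHNN.IsIndexTwoOvergroup ((CommHNN.castVec n).comp L'.subtype)
        (CommHNN.toRat R * A : Matrix (Fin n) (Fin n) ℚ) ι' →
      (∃ f : CommHNN.G A L' hL' →* CommHNN.K ι ι',
        Function.Injective f ∧ f.range.index = 2 ∧
        ∀ v : Multiplicative (Fin n → ℤ),
          f (HNNExtension.of v) = CommHNN.Amalgam.inl _ _ (ι v)) ∧
      (n = 2 →
        (∃ P : GL (Fin n) ℝ,
          ((P * CommHNN.toReal A * P⁻¹ : GL (Fin n) ℝ) : Matrix (Fin n) (Fin n) ℝ)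
            ∈ Matrix.specialOrthogonalGroup (Fin n) ℝ) →
        CommHNN.IsCAT0Group (CommHNN.K ι ι')) := by
  refine ⟨CommHNN.exists_overgroups hL' hR hRL hRA, fun H H' _ _ ι ι' hι hι' =>
    ⟨CommHNN.exists_embedding_G hL' hR hRL hι hι', fun _ ⟨_, hP⟩ => ?_⟩⟩
  exact CommHNN.isCAT0Group_K hL' hfin hR hRL hRA hι hι'
    (Matrix.mem_specialOrthogonalGroup_iff.1 hP).1
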